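/- Let $V=\mathbb C^{n|\nu}$ and $W=\mathbb C^{m|\mu}$ be complex vector superspaces, regarded as (real, smooth) supermanifolds, with linear coordinates $v^a$ and $w^k$ ($n,m$ of them even, $\nu,\mu$ odd) and their conjugates; the case $\nu=\mu=0$ is that of ordinary vector spaces. Let $V_0$, $W_0$ be the open subspaces of non-zero vectors (vectors whose body is not zero), and let $$P_{1,-1}(V\oplus W)=(V_0\times W_0)/\mathbb C^*,\qquad \lambda\cdot(v,w)=(\lambda v,\lambda^{-1}w),$$ with quotient map $q\colon V_0\times W_0\to P_{1,-1}(V\oplus W)$, $q(v,w)=[v\|w]$, and the atlas of charts $v^a\neq0$ ($v^a$ even) with inhomogeneous coordinates $v^b/v^a$ $(b\ne a)$ and $v^aw^k$. Put $\langle x,y\rangle=\sum_{a\text{ even}}x^a\overline{y^a}+\tau\sum_{a\text{ odd}}x^a\overline{y^a}$ on $V$ and on $W$, where conjugation is an algebra homomorphism (it keeps the order of products) and $\tau$ is either of $i,-i$ (the two sign conventions for odd coordinates; without odd coordinates $\tau$ plays no role). Write $v\bar v=\langle v,v\rangle$; write $dv\,\bar v$ and $v\,d\bar v=d\bar v\,v$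 for the 1-forms with values $\langle X_v,v\rangle$ and $\langle v,X_v\rangle$ on an even tangent vector $X=(X_v,X_w)$; and write $dv\,d\bar v$ for the 2-form with value $\langle X_v,Y_v\rangle-\langle Y_v,X_v\rangle$ on even tangent vectors $X,Y$ (in the purely even case this is $\sum_a dv^a\wedge d\bar v^a$). Use the same notation for $w$; products of 1-forms are wedge products. Let $$\omega_0=\tfrac i2\,(dv\,d\bar v+dw\,d\bar w),\qquad \Gamma_0=\{(v,w)\in V_0\times W_0: v\bar v=w\bar w\},$$ let $\iota\colon\Gamma_0\to V_0\times W_0$ be the inclusion, and let $p=q\circ\iota$. **Theorem.** There is a unique differential 2-form $\omega$ on $P_{1,-1}(V\oplus W)$ with $p^*\omega=\iota^*\omega_0$. It is closed and nondegenerate, hence a symplectic form. Its expression in homogeneous coordinates, i.e. its pullback to $V_0\times W_0$, is $q^*\omega=s^*\omega_0$, where $$s(v,w)=(\lambda v,\lambda^{-1}w),\qquad \lambda=\Big(\frac{w\bar w}{v\bar v}\Big)^{1/4},$$ and explicitly $$\begin{aligned}q^*\omega=\tfrac i2\,(v\bar v)^{-3/2}(w\bar w)^{-3/2}\Big(&(v\bar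 v)(w\bar w)^2\,(dv\,d\bar v)+(v\bar v)^2(w\bar w)\,(dw\,d\bar w)\\&-\tfrac12(w\bar w)^2(dv\,\bar v)(v\,d\bar v)-\tfrac12(v\bar v)^2(dw\,\bar w)(w\,d\bar w)\\&+\tfrac12(v\bar v)(w\bar w)(dw\,\bar w)(d\bar v\,v)+\tfrac12(v\bar v)(w\bar w)(dv\,\bar v)(d\bar w\,w)\Big).\end{aligned}$$ -/

import Mathlib

/-- The complexified Grassmann algebra on `L` real generators: `x S` is the coefficient of the
monomial `η_{i₁} ⋯ η_{i_k}`, where `S = {i₁ < ⋯ < i_k}`. -/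
def Grassmann (L : ℕ) : Type := Finset (Fin L) → ℂ

namespace Grassmann

open Finset

variable {L : ℕ}

noncomputable instance : AddCommGroup (Grassmann L) := inferInstanceAs (AddCommGroup (Finset (Fin L) → ℂ))
noncomputable instance : Module ℂ (Grassmann L) := inferInstanceAs (Module ℂ (Finset (Fin L) → ℂ))

@[ext] theorem ext {x y : Grassmann L} (h : ∀ S, x S = y S) : x = y := funext h
@[simp] theorem add_apply (x y : Grassmann L) (S) : (x + y) S = x S + y S := rfl
@[simp] theorem neg_apply (x : Grassmann L) (S) : (-x) S = -x S := rfl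
@[simp] theorem sub_apply (x y : Grassmann L) (S) : (x - y) S = x S - y S := rfl
@[simp] theorem zero_apply (S) : (0 : Grassmann L) S = 0 := rfl
@[simp] theorem smul_apply (c : ℂ) (x : Grassmann L) (S) : (c • x) S = c * x S := rfl

/-- The number of transpositions needed to sort the product of the monomials `S` and `T`. -/
def inversions (S T : Finset (Fin L)) : ℕ := #{ij ∈ S ×ˢ T | ij.2 < ij.1}

/-- The sign in `η_S η_T = sgn S T • η_{S ∪ T}` for disjoint `S` and `T`. -/
noncomputable def sgn (S T : Finset (Fin L)) : ℂ := (-1) ^ inversions S T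

theorem inversions_union_left {S T : Finset (Fin L)} (h : Disjoint S T) (R : Finset (Fin L)) :
    inversions (S ∪ T) R = inversions S R + inversions T R := by
  unfold inversions
  rw [Finset.union_product, Finset.filter_union, Finset.card_union_of_disjoint]
  exact Finset.disjoint_filter_filter (Finset.disjoint_product.2 (Or.inl h))

theorem inversions_union_right {S T : Finset (Fin L)} (h : Disjoint S T) (R : Finset (Fin L)) :
    inversions R (S ∪ T) = inversions R S + inversions R T := by
  unfold inversions
  rw [Finset.product_union, Finset.filter_union, Finset.card_union_of_disjoint]
  exact Finset.disjoint_filter_filter (Finset.disjoint_product.2 (Or.inr h))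

theorem inversions_add_swap {S T : Finset (Fin L)} (h : Disjoint S T) :
    inversions S T + inversions T S = #S * #T := by
  have h1 : inversions T S = #{ij ∈ S ×ˢ T | ¬ ij.2 < ij.1} := by
    unfold inversions
    refine Finset.card_bij' (fun p _ => (p.2, p.1)) (fun p _ => (p.2, p.1)) ?_ ?_ ?_ ?_
    · rintro ⟨i, j⟩ hp
      simp only [mem_filter, mem_product] at hp ⊢
      exact ⟨⟨hp.1.2, hp.1.1⟩, not_lt.2 hp.2.le⟩
    · rintro ⟨i, j⟩ hp
      simp only [mem_filter, mem_product] at hp ⊢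
      refine ⟨⟨hp.1.2, hp.1.1⟩, lt_of_le_of_ne (not_lt.1 hp.2) ?_⟩
      rintro rfl
      exact Finset.disjoint_left.1 h hp.1.1 hp.1.2
    · intros; rfl
    · intros; rfl
  rw [h1]
  unfold inversions
  rw [Finset.card_filter_add_card_filter_not, Finset.card_product]

theorem sgn_swap {S T : Finset (Fin L)} (h : Disjoint S T) :
    sgn S T = (-1) ^ (#S * #T) * sgn T S := by
  unfold sgn
  rw [← inversions_add_swap h, pow_add, mul_assoc, ← pow_add, ← two_mul, pow_mul]
  simp

noncomputable instance : One (Grassmann L) := ⟨fun S => if S = ∅ then 1 else 0⟩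

noncomputable instance : Mul (Grassmann L) :=
  ⟨fun x y U => ∑ S ∈ U.powerset, sgn S (U \ S) * x S * y (U \ S)⟩

theorem one_apply (S : Finset (Fin L)) : (1 : Grassmann L) S = if S = ∅ then 1 else 0 := rfl

theorem mul_apply (x y : Grassmann L) (U : Finset (Fin L)) :
    (x * y) U = ∑ S ∈ U.powerset, sgn S (U \ S) * x S * y (U \ S) := rfl

protected theorem mul_assoc (x y z : Grassmann L) : x * y * z = x * (y * z) := by
  ext U
  simp only [mul_apply, Finset.mul_sum, Finset.sum_mul, Finset.sum_sigma']
  refine Finset.sum_bij' (fun p _ => ⟨p.2, p.1 \ p.2⟩) (fun p _ => ⟨p.1 ∪ p.2, p.1⟩) ?_ ?_ ?_ ?_ ?_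
  · rintro ⟨S, T⟩ h
    simp only [mem_sigma, mem_powerset] at h ⊢
    exact ⟨h.2.trans h.1, Finset.sdiff_subset_sdiff h.1 le_rfl⟩
  · rintro ⟨T, R⟩ h
    simp only [mem_sigma, mem_powerset] at h ⊢
    exact ⟨Finset.union_subset h.1 (h.2.trans Finset.sdiff_subset), Finset.subset_union_left⟩
  · rintro ⟨S, T⟩ h
    simp only [mem_sigma, mem_powerset] at h ⊢
    rw [Finset.union_sdiff_of_subset h.2]
  · rintro ⟨T, R⟩ h
    simp only [mem_sigma, mem_powerset] at h ⊢
    have : Disjoint T R := (Finset.disjoint_of_subset_left h.2 Finset.sdiff_disjoint).symm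
    rw [Finset.union_sdiff_cancel_left this]
  · rintro ⟨S, T⟩ h
    simp only [mem_sigma, mem_powerset] at h ⊢
    have e1 : (U \ T) \ (S \ T) = U \ S := by
      ext i; simp only [mem_sdiff]; have := @h.2 i; tauto
    have d1 : Disjoint T (S \ T) := Finset.disjoint_sdiff
    have d2 : Disjoint (S \ T) (U \ S) :=
      Finset.disjoint_of_subset_left Finset.sdiff_subset Finset.disjoint_sdiff
    have e2 : sgn S (U \ S) = sgn T (U \ S) * sgn (S \ T) (U \ S) := by
      unfold sgn
      rw [← pow_add, ← inversions_union_left d1, Finset.union_sdiff_of_subset h.2]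
    have e3 : sgn T (U \ T) = sgn T (S \ T) * sgn T (U \ S) := by
      unfold sgn
      rw [← pow_add, ← inversions_union_right d2]
      congr 2
      ext i; simp only [mem_sdiff, mem_union]; have := @h.2 i; have := @h.1 i; tauto
    rw [e1, e2, e3]
    ring

noncomputable instance : Ring (Grassmann L) :=
  { (inferInstance : AddCommGroup (Grassmann L)) with
    mul := (· * ·)
    one := 1
    mul_assoc := Grassmann.mul_assoc
    one_mul := fun x => by
      ext U
      rw [mul_apply, Finset.sum_eq_single ∅]
      · simp [one_apply, sgn, inversions]
      · intro S _ h; simp [one_apply, h]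
      · intro h; simp at h
    mul_one := fun x => by
      ext U
      rw [mul_apply, Finset.sum_eq_single U]
      · simp [one_apply, sgn, inversions]
      · intro S hS h
        have : U \ S ≠ ∅ := fun h0 =>
          h (Finset.Subset.antisymm (mem_powerset.1 hS) (Finset.sdiff_eq_empty_iff_subset.1 h0))
        simp [one_apply, this]
      · intro h; simp at h
    zero_mul := fun x => by ext U; simp [mul_apply]
    mul_zero := fun x => by ext U; simp [mul_apply]
    left_distrib := fun x y z => by
      ext U; simp [mul_apply, mul_add, Finset.sum_add_distrib]
    right_distrib := fun x y z => by
      ext U; simp [mul_apply, mul_add, add_mul, Finset.sum_add_distrib] }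

noncomputable instance : Algebra ℂ (Grassmann L) :=
  Algebra.ofModule
    (fun c x y => by
      ext U; simp only [mul_apply, smul_apply, Finset.mul_sum]
      exact Finset.sum_congr rfl fun S _ => by ring)
    (fun c x y => by
      ext U; simp only [mul_apply, smul_apply, Finset.mul_sum]
      exact Finset.sum_congr rfl fun S _ => by ring)

noncomputable instance : NormedAddCommGroup (Grassmann L) :=
  AddGroupNorm.toNormedAddCommGroup
    { toFun := fun x => ∑ S, ‖x S‖
      map_zero' := by simp
      add_le' := fun x y => by
        rw [← Finset.sum_add_distrib]
        exact Finset.sum_le_sum fun S _ => norm_add_le _ _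
      neg' := fun x => by simp
      eq_zero_of_map_eq_zero' := fun x h => by
        ext S
        have := (Finset.sum_eq_zero_iff_of_nonneg (fun S _ => norm_nonneg (x S))).1 h S (mem_univ S)
        simpa using this }

theorem norm_def (x : Grassmann L) : ‖x‖ = ∑ S, ‖x S‖ := rfl

theorem norm_sgn (S T : Finset (Fin L)) : ‖sgn S T‖ = 1 := by simp [sgn]

noncomputable instance : NormedRing (Grassmann L) :=
  { (inferInstance : Ring (Grassmann L)), (inferInstance : NormedAddCommGroup (Grassmann L)) with
    norm_mul_le := fun x y => by
      simp only [norm_def]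
      calc ∑ U, ‖(x * y) U‖ ≤ ∑ U : Finset (Fin L), ∑ S ∈ U.powerset, ‖x S‖ * ‖y (U \ S)‖ := by
            refine Finset.sum_le_sum fun U _ => (norm_sum_le _ _).trans (le_of_eq ?_)
            simp [norm_sgn]
        _ = ∑ p ∈ (univ : Finset (Finset (Fin L))).sigma fun U => U.powerset,
              ‖x p.2‖ * ‖y (p.1 \ p.2)‖ := by rw [Finset.sum_sigma']
        _ = ∑ r ∈ ((univ : Finset (Finset (Fin L))).sigma fun U => U.powerset).image
              (fun p => (p.2, p.1 \ p.2)), ‖x r.1‖ * ‖y r.2‖ := by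
            rw [Finset.sum_image]
            rintro ⟨U, S⟩ h ⟨U', S'⟩ h' he
            simp only [coe_sigma, Set.mem_sigma_iff, mem_coe, mem_powerset, mem_univ, true_and,
              Prod.mk.injEq] at h h' he
            obtain ⟨rfl, h2⟩ := he
            have : U = U' := by
              rw [← Finset.union_sdiff_of_subset h, h2, Finset.union_sdiff_of_subset h']
            subst this; rfl
        _ ≤ ∑ r : Finset (Fin L) × Finset (Fin L), ‖x r.1‖ * ‖y r.2‖ :=
            Finset.sum_le_sum_of_subset_of_nonneg (subset_univ _) fun _ _ _ => by positivity
        _ = (∑ S, ‖x S‖) * ∑ S, ‖y S‖ := by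
            rw [Finset.sum_mul_sum, ← Finset.univ_product_univ, Finset.sum_product] }

noncomputable instance : NormedAlgebra ℂ (Grassmann L) :=
  { (inferInstance : Algebra ℂ (Grassmann L)) with
    norm_smul_le := fun c x => by simp [norm_def, Finset.mul_sum] }

/-- The even part of the Grassmann algebra. -/
noncomputable def evenPart (L : ℕ) : Subalgebra ℂ (Grassmann L) where
  carrier := {x | ∀ S, ¬ Even #S → x S = 0}
  add_mem' hx hy S hS := by simp [hx S hS, hy S hS]
  mul_mem' {x y} hx hy U hU := by
    rw [mul_apply]
    refine Finset.sum_eq_zero fun S hS => ?_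
    by_cases h : Even #S
    · have : ¬ Even #(U \ S) := fun h' => hU (by
        rw [← Finset.card_sdiff_add_card_eq_card (mem_powerset.1 hS)]; exact h'.add h)
      simp [hy _ this]
    · simp [hx _ h]
  algebraMap_mem' c S hS := by
    have : S ≠ ∅ := by rintro rfl; simp at hS
    rw [Algebra.algebraMap_eq_smul_one]; simp [one_apply, this]

/-- The odd part of the Grassmann algebra. -/
def oddPart (L : ℕ) : Submodule ℂ (Grassmann L) where
  carrier := {x | ∀ S, Even #S → x S = 0}
  add_mem' hx hy S hS := by simp [hx S hS, hy S hS]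
  zero_mem' S _ := rfl
  smul_mem' c x hx S hS := by simp [hx S hS]

theorem ev_mul_od {x y : Grassmann L} (hx : x ∈ evenPart L) (hy : y ∈ oddPart L) : x * y ∈ oddPart L := by
  intro U hU
  rw [mul_apply]
  refine Finset.sum_eq_zero fun S hS => ?_
  by_cases h : Even #S
  · have : Even #(U \ S) := by
      rw [← Finset.card_sdiff_add_card_eq_card (mem_powerset.1 hS), Nat.even_add] at hU
      exact hU.2 h
    simp [hy _ this]
  · simp [hx _ h]

theorem od_mul_od {x y : Grassmann L} (hx : x ∈ oddPart L) (hy : y ∈ oddPart L) : x * y ∈ evenPart L := by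
  intro U hU
  rw [mul_apply]
  refine Finset.sum_eq_zero fun S hS => ?_
  by_cases h : Even #S
  · simp [hx _ h]
  · have : Even #(U \ S) := by
      rw [← Finset.card_sdiff_add_card_eq_card (mem_powerset.1 hS), Nat.even_add] at hU
      by_contra h'; exact hU ⟨fun a => (h' a).elim, fun a => (h a).elim⟩
    simp [hy _ this]

theorem ev_mul_comm {x : Grassmann L} (hx : x ∈ evenPart L) (y : Grassmann L) : x * y = y * x := by
  ext U
  rw [mul_apply, mul_apply]
  refine Finset.sum_bij' (fun S _ => U \ S) (fun S _ => U \ S) ?_ ?_ ?_ ?_ ?_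
  · intro S _; simp
  · intro S _; simp
  · intro S hS; exact Finset.sdiff_sdiff_eq_self (mem_powerset.1 hS)
  · intro S hS; exact Finset.sdiff_sdiff_eq_self (mem_powerset.1 hS)
  · intro S hS
    simp only [Finset.sdiff_sdiff_eq_self (mem_powerset.1 hS)]
    by_cases h : Even #S
    · rw [sgn_swap (Finset.disjoint_sdiff (s := S) (t := U)), (h.mul_right _).neg_one_pow]; ring
    · simp [hx _ h]

/-- The type of even elements. -/
def Ev (L : ℕ) : Type := evenPart L

/-- The type of odd elements. -/
def Od (L : ℕ) : Type := oddPart L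

instance : CoeOut (Ev L) (Grassmann L) := ⟨fun x => x.1⟩
instance : CoeOut (Od L) (Grassmann L) := ⟨fun x => x.1⟩

noncomputable instance : NormedCommRing (Ev L) :=
  { (inferInstance : NormedRing (evenPart L)) with
    mul_comm := fun x y => Subtype.ext (ev_mul_comm x.2 y.1) }

noncomputable instance : NormedAlgebra ℂ (Ev L) := inferInstanceAs (NormedAlgebra ℂ (evenPart L))
noncomputable instance : NormedAddCommGroup (Od L) := inferInstanceAs (NormedAddCommGroup (oddPart L))
noncomputable instance : NormedSpace ℂ (Od L) := inferInstanceAs (NormedSpace ℂ (oddPart L))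
noncomputable instance : NormedAlgebra ℝ (Ev L) := NormedAlgebra.complexToReal
noncomputable instance : NormedSpace ℝ (Od L) := NormedSpace.complexToReal
noncomputable instance : NormedAlgebra ℝ (Grassmann L) := NormedAlgebra.complexToReal
noncomputable instance : NormedSpace ℝ (Ev L) := NormedAlgebra.toNormedSpace (Ev L)
noncomputable instance : NormedSpace ℝ (Grassmann L) := NormedAlgebra.toNormedSpace (Grassmann L)
noncomputable instance : Module ℝ (Ev L) := Algebra.toModule
noncomputable instance : Module ℝ (Grassmann L) := Algebra.toModule

theorem Ev.ext {x y : Ev L} (h : (x : Grassmann L) = y) : x = y := Subtype.ext h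
theorem Od.ext {x y : Od L} (h : (x : Grassmann L) = y) : x = y := Subtype.ext h
theorem Ev.coe_add (x y : Ev L) : ((x + y : Ev L) : Grassmann L) = x + y := rfl
theorem Ev.coe_mul (x y : Ev L) : ((x * y : Ev L) : Grassmann L) = x * y := rfl
theorem Ev.coe_smul (c : ℂ) (x : Ev L) : ((c • x : Ev L) : Grassmann L) = c • (x : Grassmann L) := rfl
theorem Ev.norm_coe (x : Ev L) : ‖(x : Grassmann L)‖ = ‖x‖ := rfl
theorem Od.norm_coe (x : Od L) : ‖(x : Grassmann L)‖ = ‖x‖ := rfl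

/-- Odd elements form a module over the even ones. -/
noncomputable instance : Module (Ev L) (Od L) where
  smul c x := ⟨c.1 * x.1, ev_mul_od c.2 x.2⟩
  one_smul _ := Subtype.ext (one_mul _)
  mul_smul _ _ _ := Subtype.ext (mul_assoc _ _ _)
  smul_zero _ := Subtype.ext (mul_zero _)
  smul_add _ _ _ := Subtype.ext (mul_add _ _ _)
  add_smul _ _ _ := Subtype.ext (add_mul _ _ _)
  zero_smul _ := Subtype.ext (zero_mul _)

/-- Complex conjugation, the antilinear algebra homomorphism that fixes the generators. -/
noncomputable def conj : Grassmann L →+* Grassmann L where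
  toFun x S := starRingEnd ℂ (x S)
  map_one' := by ext S; simp only [one_apply]; split_ifs <;> simp
  map_zero' := by ext S; simp
  map_add' x y := by ext S; exact map_add _ _ _
  map_mul' x y := by
    ext U
    change starRingEnd ℂ ((x * y) U) = _
    rw [mul_apply, map_sum]
    exact Finset.sum_congr rfl fun S _ => by simp [sgn]

theorem conj_apply (x : Grassmann L) (S) : conj x S = starRingEnd ℂ (x S) := rfl

theorem conj_mem_ev {x : Grassmann L} (hx : x ∈ evenPart L) : conj x ∈ evenPart L := fun S hS => by
  simp [conj_apply, hx S hS]

theorem conj_mem_od {x : Grassmann L} (hx : x ∈ oddPart L) : conj x ∈ oddPart L := fun S hS => by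
  simp [conj_apply, hx S hS]

/-- Conjugation on the even part. -/
noncomputable def conjEv (x : Ev L) : Ev L := ⟨conj x.1, conj_mem_ev x.2⟩

/-- Conjugation on the odd part. -/
noncomputable def conjOd (x : Od L) : Od L := ⟨conj x.1, conj_mem_od x.2⟩

/-- The product of two odd elements, as an even element. -/
noncomputable def odMul (x y : Od L) : Ev L := ⟨x.1 * y.1, od_mul_od x.2 y.2⟩

/-- The body (number part) of an even element. -/
def body (x : Ev L) : ℂ := (x : Grassmann L) ∅

/-- The soul (nilpotent part) of an even element. -/
noncomputable def soul (x : Ev L) : Ev L := x - algebraMap ℂ (Ev L) (body x)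

/-- The power `A ^ s` of an even element with positive real body `a`, through the binomial series
`∑ₖ (s choose k) a ^ (s - k) (A - a) ^ k`, which terminates because products of more than `L`
nilpotent elements vanish. -/
noncomputable def pow (A : Ev L) (s : ℝ) : Ev L :=
  ∑ k ∈ range (L + 1), ((Ring.choose s k * (body A).re ^ (s - k) : ℝ) : ℂ) • soul A ^ k

theorem body_mul (x y : Ev L) : body (x * y) = body x * body y := by
  change ((x : Grassmann L) * (y : Grassmann L)) ∅ = _
  simp [mul_apply, body, sgn, inversions]

theorem body_one : body (1 : Ev L) = 1 := by
  change (1 : Grassmann L) ∅ = 1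
  simp [one_apply]

theorem soul_pow_apply (x : Ev L) (k : ℕ) (S : Finset (Fin L)) (h : #S < k) :
    ((soul x ^ k : Ev L) : Grassmann L) S = 0 := by
  induction k generalizing S with
  | zero => simp at h
  | succ k ih =>
    rw [pow_succ]
    change (((soul x ^ k : Ev L) : Grassmann L) * ((soul x : Ev L) : Grassmann L)) S = 0
    rw [mul_apply]
    refine Finset.sum_eq_zero fun T hT => ?_
    by_cases hST : S \ T = ∅
    · have h0 : ((soul x : Ev L) : Grassmann L) ∅ = 0 := by
        change (x : Grassmann L) ∅ - (algebraMap ℂ (Grassmann L) (body x)) ∅ = 0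
        simp [Algebra.algebraMap_eq_smul_one, one_apply, body]
      rw [hST, h0, mul_zero]
    · have h1 := Finset.card_sdiff_add_card_eq_card (mem_powerset.1 hT)
      have h2 : 0 < #(S \ T) := Finset.card_pos.2 (Finset.nonempty_iff_ne_empty.2 hST)
      rw [ih T (by omega)]
      simp

theorem soul_pow_eq_zero (x : Ev L) : soul x ^ (L + 1) = 0 := by
  refine Subtype.ext (ext fun S => ?_)
  refine (soul_pow_apply x (L + 1) S ?_).trans rfl
  have := Finset.card_le_univ S
  simp at this
  omega

/-- An even element is invertible if and only if its body is not zero. -/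
theorem isUnit_iff (x : Ev L) : IsUnit x ↔ body x ≠ 0 := by
  constructor
  · rintro ⟨u, rfl⟩ h
    have := body_mul (u : Ev L) ((u⁻¹ : (Ev L)ˣ) : Ev L)
    rw [Units.mul_inv, body_one, h, zero_mul] at this
    exact one_ne_zero this
  · intro h
    have h1 : IsUnit (algebraMap ℂ (Ev L) (body x)) := (isUnit_iff_ne_zero.2 h).map _
    have h2 : IsNilpotent (soul x) := ⟨_, soul_pow_eq_zero x⟩
    have h3 := h2.isUnit_add_left_of_commute h1 (Commute.all _ _)
    simpa [soul] using h3

end Grassmann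

/-- An even homomorphism of Grassmann algebras that respects their real forms. -/
structure GrassmannHom (L L' : ℕ) extends Grassmann L →ₐ[ℂ] Grassmann L' where
  map_ev : ∀ x ∈ Grassmann.evenPart L, toFun x ∈ Grassmann.evenPart L'
  map_od : ∀ x ∈ Grassmann.oddPart L, toFun x ∈ Grassmann.oddPart L'
  map_conj : ∀ x, toFun (Grassmann.conj x) = Grassmann.conj (toFun x)

/-- The points, over the Grassmann algebra with `L` generators, of the complex vector superspace
with even coordinates indexed by `ι` and `p` odd coordinates. -/
abbrev SVec (ι : Type) (p L : ℕ) : Type :=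
  (ι → Grassmann.Ev L) × (Fin p → Grassmann.Od L)

/-- The map of points induced by a homomorphism of Grassmann algebras. -/
def SVec.map {ι : Type} {p L L' : ℕ} (φ : GrassmannHom L L') (v : SVec ι p L) : SVec ι p L' :=
  (fun a => ⟨φ.toFun (v.1 a).1, φ.map_ev _ (v.1 a).2⟩, fun j => ⟨φ.toFun (v.2 j).1, φ.map_od _ (v.2 j).2⟩)

/-- The points of the open subspace of non-zero vectors: the body is not the zero vector. -/
def SVec.IsNonzero {ι : Type} {p L : ℕ} (v : SVec ι p L) : Prop := ∃ a, Grassmann.body (v.1 a) ≠ 0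

/-- The Hermitian pairing `∑ vᵃ v̄'ᵃ + τ ∑ ξʲ ξ̄'ʲ` (`vᵃ` even, `ξʲ` odd coordinates). It is
Hermitian for `τ = ± i`, the two possible sign conventions for the odd coordinates. -/
noncomputable def SVec.herm {ι : Type} [Fintype ι] {p L : ℕ} (τ : ℂ) (v v' : SVec ι p L) :
    Grassmann.Ev L :=
  ∑ a, v.1 a * Grassmann.conjEv (v'.1 a) +
    τ • ∑ j, Grassmann.odMul (v.2 j) (Grassmann.conjOd (v'.2 j))

namespace WeightedProj

open Grassmann

variable {n p m q L : ℕ}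

/-- The points of `V ⊕ W` for `V = ℂ^{n|p}` and `W = ℂ^{m|q}`. -/
abbrev Pt (n p m q L : ℕ) : Type := SVec (Fin n) p L × SVec (Fin m) q L

/-- The points of `V₀ × W₀`. -/
def X₀ (n p m q L : ℕ) : Set (Pt n p m q L) := {x | x.1.IsNonzero ∧ x.2.IsNonzero}

/-- Being in the same orbit of the action `g · (v, w) = (g v, g⁻¹ w)` of the points of `ℂ*`. -/
def orbitSetoid (n p m q L : ℕ) : Setoid (Pt n p m q L) where
  r x y := ∃ g : (Ev L)ˣ, y = ((g : Ev L) • x.1, ((g⁻¹ : (Ev L)ˣ) : Ev L) • x.2)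
  iseqv :=
    { refl := fun x => ⟨1, by simp⟩
      symm := by
        rintro x _ ⟨g, rfl⟩
        exact ⟨g⁻¹, by simp [smul_smul]⟩
      trans := by
        rintro x _ _ ⟨g, rfl⟩ ⟨h, rfl⟩
        exact ⟨h * g, by simp [smul_smul, mul_comm]⟩ }

/-- The space of all orbits in `V × W`. -/
def OrbitSpace (n p m q L : ℕ) : Type := Quotient (orbitSetoid n p m q L)

/-- The quotient map `(v, w) ↦ [v ‖ w]`. -/
def proj (x : Pt n p m q L) : OrbitSpace n p m q L := Quotient.mk (orbitSetoid n p m q L) x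

/-- The points of `P_{1,-1}(V ⊕ W) = (V₀ × W₀) / ℂ*`. -/
def P (n p m q L : ℕ) : Set (OrbitSpace n p m q L) := proj '' X₀ n p m q L

/-- The space of inhomogeneous coordinates of the chart `vᵃ ≠ 0`: the even coordinates of `V` other
than `vᵃ`, the odd coordinates of `V`, and the coordinates of `W`. -/
abbrev Model (n p m q L : ℕ) (a : Fin n) : Type :=
  SVec {b : Fin n // b ≠ a} p L × SVec (Fin m) q L

/-- The chart `[v ‖ w] ↦ (v / vᵃ, vᵃ w)`, where the coordinate `1` of `v / vᵃ` is left out. -/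
noncomputable def chart (a : Fin n) : OrbitSpace n p m q L → Model n p m q L a :=
  Quotient.lift
    (fun x : Pt n p m q L =>
      ((fun b => Ring.inverse (x.1.1 a) * x.1.1 b, Ring.inverse (x.1.1 a) • x.1.2),
        x.1.1 a • x.2))
    (by
      rintro x _ ⟨g, rfl⟩
      have h : ∀ z : Ev L, Ring.inverse ((g : Ev L) * z) * g = Ring.inverse z := fun z => by
        rw [Ring.mul_inverse_rev, Ring.inverse_unit, mul_assoc, Units.inv_mul, mul_one]
      refine Prod.ext (Prod.ext (funext fun b => ?_) ?_) ?_
      · simp only [Prod.smul_fst, Pi.smul_apply, smul_eq_mul]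
        rw [← mul_assoc, h]
      · simp only [Prod.smul_fst, Prod.smul_snd, Pi.smul_apply, smul_eq_mul]
        rw [smul_smul, h]
      · simp only [Prod.smul_fst, Pi.smul_apply, smul_eq_mul]
        rw [smul_smul, mul_right_comm, Units.mul_inv, one_mul])

/-- The domain of the chart. -/
def source (a : Fin n) : Set (OrbitSpace n p m q L) :=
  proj '' {x | x ∈ X₀ n p m q L ∧ body (x.1.1 a) ≠ 0}

/-- The image of the chart, an open subset. -/
def target (a : Fin n) : Set (Model n p m q L a) := {y | y.2.IsNonzero}

/-- The homogeneous coordinates with `vᵃ = 1`. -/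
noncomputable def slice (a : Fin n) (y : Model n p m q L a) : Pt n p m q L :=
  ((fun b => if h : b = a then 1 else y.1.1 ⟨b, h⟩, y.1.2), y.2)

/-- The charts cover the whole space. -/
theorem iUnion_source : ⋃ a, source a = P n p m q L := by
  ext z
  simp only [source, P, Set.mem_iUnion, Set.mem_image, Set.mem_ofPred_eq]
  constructor
  · rintro ⟨a, x, ⟨hx, -⟩, rfl⟩
    exact ⟨x, hx, rfl⟩
  · rintro ⟨x, hx, rfl⟩
    obtain ⟨a, ha⟩ := hx.1
    exact ⟨a, x, ⟨hx, ha⟩, rfl⟩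

/-- Each chart is a bijection of its domain onto its image, with inverse `proj ∘ slice a`. -/
theorem chart_invOn (a : Fin n) :
    Set.InvOn (fun y => proj (slice a y)) (chart a) (source a) (target (p := p) (m := m) (q := q)
      (L := L) a) ∧ Set.MapsTo (chart a) (source a) (target (p := p) (m := m) (q := q) (L := L) a) ∧
      Set.MapsTo (fun y => proj (slice a y)) (target (p := p) (m := m) (q := q) (L := L) a)
        (source a) := by
  refine ⟨⟨?_, ?_⟩, ?_, ?_⟩
  · rintro _ ⟨x, ⟨-, hx⟩, rfl⟩
    obtain ⟨u, hu⟩ := (isUnit_iff _).2 hx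
    refine Quotient.sound ⟨u, ?_⟩
    refine Prod.ext (Prod.ext (funext fun b => ?_) ?_) ?_
    · by_cases h : b = a
      · subst h; simp [slice, hu]
      · simp [slice, chart, proj, h, ← hu]
    · simp [slice, chart, proj, ← hu, smul_smul]
    · simp [slice, chart, proj, ← hu, smul_smul]
  · intro y hy
    refine Prod.ext (Prod.ext (funext fun b => ?_) ?_) ?_
    · simp [slice, chart, proj, b.2]
    · simp [slice, chart, proj]
    · simp [slice, chart, proj]
  · rintro _ ⟨x, ⟨hx, hxa⟩, rfl⟩
    obtain ⟨i, hi⟩ := hx.2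
    refine ⟨i, ?_⟩
    change body (x.1.1 a * x.2.1 i) ≠ 0
    rw [body_mul]
    exact mul_ne_zero hxa hi
  · intro y hy
    refine ⟨slice a y, ⟨⟨⟨a, ?_⟩, hy⟩, ?_⟩, rfl⟩ <;> simp [slice, body_one]

/-- The data of a complex-valued 2-form on `P_{1,-1}(V ⊕ W)`: for each Grassmann algebra and each
chart a 2-form on the points of the chart. Its value on a pair of tangent vectors is the value of
the superform on the corresponding pair of even tangent vectors. -/
abbrev FormData (n p m q : ℕ) : Type :=
  ∀ (L : ℕ) (a : Fin n), Model n p m q L a → Model n p m q L a [⋀^Fin 2]→L[ℝ] Grassmann L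

/-- The pullback of `ω` by a map `f` from a normed space into `P_{1,-1}(V ⊕ W)`, at a point that `f`
takes into the domain of the chart `a`. -/
noncomputable def pullback (ω : FormData n p m q) {E : Type*} [NormedAddCommGroup E]
    [NormedSpace ℝ E] (f : E → OrbitSpace n p m q L) (a : Fin n) (x : E) :
    E [⋀^Fin 2]→L[ℝ] Grassmann L :=
  (ω L a (chart a (f x))).compContinuousLinearMap (fderiv ℝ (fun x' => chart a (f x')) x)

/-- `ω` is a (smooth, complex-valued) differential 2-form on the supermanifold
`P_{1,-1}(V ⊕ W)`. Superfunctions and superforms are given through the functor of points: they are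
smooth on the points over each Grassmann algebra, linear (the forms themselves, and the derivatives
of their coefficients) over the real even elements, and natural in the Grassmann algebra. -/
structure IsForm (ω : FormData n p m q) : Prop where
  smooth : ∀ (L : ℕ) (a : Fin n), ContDiffOn ℝ (⊤ : ℕ∞) (ω L a) (target a)
  linear : ∀ (L : ℕ) (a : Fin n), ∀ y ∈ target a, ∀ c : Ev L, conjEv c = c → ∀ X Y : Model n p m q L a,
    ω L a y ![c • X, Y] = c * ω L a y ![X, Y]
  deriv_linear : ∀ (L : ℕ) (a : Fin n), ∀ y ∈ target a, ∀ c : Ev L, conjEv c = c → ∀ X Y Z : Model n p m q L a,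
    fderiv ℝ (fun y' => ω L a y' ![X, Y]) y (c • Z) =
      c * fderiv ℝ (fun y' => ω L a y' ![X, Y]) y Z
  natural : ∀ (L L' : ℕ) (φ : GrassmannHom L L') (a : Fin n), ∀ y ∈ target a, ∀ X Y : Model n p m q L a,
    ω L' a (y.1.map φ, y.2.map φ) ![(X.1.map φ, X.2.map φ), (Y.1.map φ, Y.2.map φ)] =
      φ.toFun (ω L a y ![X, Y])
  /-- The local expressions in two charts are related by the change of coordinates. -/
  compatible : ∀ (L : ℕ) (a b : Fin n), ∀ y ∈ target b, proj (slice b y) ∈ source a →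
    pullback ω (fun y' => proj (slice b y')) a y = ω L b y

/-- `dω = 0`. -/
def IsClosedForm (ω : FormData n p m q) : Prop :=
  ∀ (L : ℕ) (a : Fin n), ∀ y ∈ target a, extDeriv (ω L a) y = 0

/-- Nondegeneracy. For a tangent vector over a given Grassmann algebra, the vectors it is paired
with have coordinates in arbitrary larger Grassmann algebras. -/
def IsNondegenerate (ω : FormData n p m q) : Prop :=
  ∀ (L : ℕ) (a : Fin n), ∀ y ∈ target a, ∀ X : Model n p m q L a,
    (∀ (L' : ℕ) (φ : GrassmannHom L L') (Y : Model n p m q L' a),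
      ω L' a (y.1.map φ, y.2.map φ) ![(X.1.map φ, X.2.map φ), Y] = 0) → X = 0

/-- The Hamiltonian `H = (v v̄ - w w̄) / 2`. -/
noncomputable def ham (τ : ℂ) (x : Pt n p m q L) : Ev L :=
  (1 / 2 : ℝ) • (x.1.herm τ x.1 - x.2.herm τ x.2)

/-- The level set `Γ₀ = {v v̄ = w w̄}` in `V₀ × W₀`. -/
def Γ₀ (n p m q L : ℕ) (τ : ℂ) : Set (Pt n p m q L) := {x | x ∈ X₀ n p m q L ∧ ham τ x = 0}

/-- The tangent vectors to `Γ₀` at `x`. -/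
def tangentΓ₀ (τ : ℂ) (x : Pt n p m q L) : Set (Pt n p m q L) := {X | fderiv ℝ (ham τ) x X = 0}

/-- The value of `dv dv̄` on `X, Y`. -/
noncomputable def dd {ι : Type} [Fintype ι] (τ : ℂ) (X Y : SVec ι p L) : Ev L :=
  X.herm τ Y - Y.herm τ X

/-- The value of `ω₀ = (i/2) (dv dv̄ + dw dw̄)` on `X, Y`. -/
noncomputable def ω₀ (τ : ℂ) (X Y : Pt n p m q L) : Ev L :=
  (Complex.I / 2) • (dd τ X.1 Y.1 + dd τ X.2 Y.2)

/-- `p^* ω = i^* ω₀` on `Γ₀`, for the inclusion `i` of `Γ₀` in `V₀ × W₀` and the restriction `p` of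
the quotient map to `Γ₀`. -/
def IsReductionOf (τ : ℂ) (ω : FormData n p m q) : Prop :=
  ∀ (L : ℕ), ∀ x ∈ Γ₀ n p m q L τ, ∀ a : Fin n, proj x ∈ source a →
    ∀ X ∈ tangentΓ₀ τ x, ∀ Y ∈ tangentΓ₀ τ x, pullback ω proj a x ![X, Y] = ω₀ τ X Y

/-- `s (v, w) = (λ v, λ⁻¹ w)` for `λ = (w w̄ / v v̄) ^ (1/4)`. -/
noncomputable def s (τ : ℂ) (x : Pt n p m q L) : Pt n p m q L :=
  let lam := Grassmann.pow (x.2.herm τ x.2 * Ring.inverse (x.1.herm τ x.1)) (1 / 4)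
  (lam • x.1, Ring.inverse lam • x.2)

/-- The value on `X, Y` of the wedge product of two 1-forms with even coefficients. -/
noncomputable def wedge (α β : Pt n p m q L → Ev L) (X Y : Pt n p m q L) : Ev L :=
  α X * β Y - α Y * β X

/-- The value on `X, Y` of the explicit form in the homogeneous coordinates `x = (v, w)`. -/
noncomputable def explicitForm (τ : ℂ) (x X Y : Pt n p m q L) : Ev L :=
  let A := x.1.herm τ x.1
  let B := x.2.herm τ x.2
  let dv_v : Pt n p m q L → Ev L := fun Z => Z.1.herm τ x.1
  let v_dv : Pt n p m q L → Ev L := fun Z => x.1.herm τ Z.1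
  let dw_w : Pt n p m q L → Ev L := fun Z => Z.2.herm τ x.2
  let w_dw : Pt n p m q L → Ev L := fun Z => x.2.herm τ Z.2
  (Complex.I / 2) • (Grassmann.pow A (-3 / 2) * Grassmann.pow B (-3 / 2) *
    (A * B ^ 2 * dd τ X.1 Y.1 + A ^ 2 * B * dd τ X.2 Y.2
      - (1 / 2 : ℝ) • (B ^ 2 * wedge dv_v v_dv X Y)
      - (1 / 2 : ℝ) • (A ^ 2 * wedge dw_w w_dw X Y)
      + (1 / 2 : ℝ) • (A * B * wedge dw_w v_dv X Y)
      + (1 / 2 : ℝ) • (A * B * wedge dv_v w_dw X Y)))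

end WeightedProj

/-! The factor `λ` in `s` is real and satisfies `λ⁴ A = B` for `A = v v̄`, `B = w w̄`, so `s` moves
a point inside its orbit onto `Γ₀`. Hence `s ∘ slice a` is, in the chart `vᵃ ≠ 0`, a section of the
quotient map with values in `Γ₀`. A form whose pullback to `Γ₀` is `ω₀` must therefore be `(s ∘
slice a)^* ω₀` in that chart (`reduction_unique`). This formula serves as the definition of `form`;
smoothness and closedness follow at once, since `ω₀` has constant coefficients and `d` commutes with
pullbacks.

What remains is to see that the local formulas fit together. Differentiating `λ⁴ A = B` gives `dλ`,
and substitution yields `s^* ω₀ = explicitForm` (`omega_scaled`, `omega_fderiv_s`). The explicit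
form is basic: it is invariant under `ℂ*` (`bracket_act`, `weight_act`) and vanishes on vectors
tangent to the orbits (`bracket_vertical`). So it is the pullback of `form` in every chart
(`pullback_proj`), which also gives compatibility of charts. On vectors tangent to `Γ₀` its
quadratic terms cancel and it reduces to `ω₀` (`explicitForm_of_tangent`).

For nondegeneracy the bracket is written as `z - z̄`, where `z` is the Hermitian pairing of a vector
`dual x X` with `Y`. Testing with `Y` and `iY` gives `z = 0`; the pairing detects every vector once
one new odd generator is available, and `dual x X = 0` forces `X = 0` for `X` tangent to a slice.

Fractional powers enter the algebra through polynomial identities: real even elements with positive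
body are units, and a positive square root is unique. So `λ` is governed by `λ⁴ A = B`, the weight
`W` by `W² (A B)³ = 1`, and the computations take place in a commutative ring. -/

namespace Grassmann

open Finset

variable {L : ℕ}

/-! ### Body, conjugation and real powers of even elements. -/

/-- The body, as a homomorphism of algebras. -/
noncomputable def bodyHom (L : ℕ) : Ev L →ₐ[ℂ] ℂ where
  toFun := body
  map_one' := body_one
  map_mul' := body_mul
  map_zero' := rfl
  map_add' _ _ := rfl
  commutes' c := by
    change (algebraMap ℂ (Grassmann L) c) ∅ = c
    simp [Algebra.algebraMap_eq_smul_one, one_apply]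

theorem bodyHom_apply (x : Ev L) : bodyHom L x = body x := rfl

/-- Conjugation of even elements, as a homomorphism of rings. -/
noncomputable def conjHom (L : ℕ) : Ev L →+* Ev L where
  toFun := conjEv
  map_one' := Ev.ext (map_one conj)
  map_mul' x y := Ev.ext (map_mul conj (x : Grassmann L) y)
  map_zero' := Ev.ext (map_zero conj)
  map_add' x y := Ev.ext (map_add conj (x : Grassmann L) y)

theorem conjEv_eq (x : Ev L) : conjEv x = conjHom L x := rfl

theorem conjHom_smul (c : ℂ) (x : Ev L) :
    conjHom L (c • x) = (starRingEnd ℂ c) • conjHom L x :=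
  Ev.ext (ext fun _ => map_mul (starRingEnd ℂ) _ _)

theorem real_smul_eq (c : ℝ) (x : Ev L) : c • x = (c : ℂ) • x := rfl

theorem conjHom_real_smul (c : ℝ) (x : Ev L) : conjHom L (c • x) = c • conjHom L x := by
  rw [real_smul_eq, conjHom_smul, Complex.conj_ofReal, real_smul_eq]

theorem conjHom_conjHom (x : Ev L) : conjHom L (conjHom L x) = x :=
  Ev.ext (ext fun _ => Complex.conj_conj _)

theorem body_conjHom (x : Ev L) : body (conjHom L x) = starRingEnd ℂ (body x) := rfl

theorem body_soul (x : Ev L) : body (soul x) = 0 := by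
  rw [← bodyHom_apply, soul, map_sub, AlgHom.commutes, bodyHom_apply]
  simp

theorem body_add_soul (x : Ev L) : algebraMap ℂ (Ev L) (body x) + soul x = x := by
  simp [soul]

theorem soul_pow_eq_zero_of_lt (x : Ev L) {k : ℕ} (h : L < k) : soul x ^ k = 0 :=
  pow_eq_zero_of_le h (soul_pow_eq_zero x)

theorem pow_eq_sum_range (A : Ev L) (s : ℝ) {M : ℕ} (h : L < M) :
    pow A s = ∑ k ∈ range M, ((Ring.choose s k * (body A).re ^ (s - k) : ℝ) : ℂ) • soul A ^ k := by
  refine Finset.sum_subset (Finset.range_subset_range.2 h) fun k _ hk => ?_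
  rw [soul_pow_eq_zero_of_lt A (by simpa using hk), smul_zero]

open Polynomial in
-- Both sides are polynomials in the soul. Their coefficients agree up to degree `L` by the
-- Chu–Vandermonde identity `Ring.add_choose_eq`, and the remainder is divisible by `X ^ (L + 1)`,
-- which the soul annihilates.
theorem pow_mul_pow {A : Ev L} (hA : 0 < (body A).re) (s t : ℝ) :
    pow A s * pow A t = pow A (s + t) := by
  let c : ℝ → ℕ → ℂ := fun s k => ((Ring.choose s k * (body A).re ^ (s - k) : ℝ) : ℂ)
  let P : ℝ → ℂ[X] := fun s => ∑ k ∈ range (L + 1), monomial k (c s k)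
  have hP : ∀ s, pow A s = aeval (soul A) (P s) := fun s => by
    simp [P, pow, c, aeval_monomial, Algebra.smul_def]
  have hc : ∀ s k, k < L + 1 → (P s).coeff k = c s k := fun s k hk => by
    simp only [P, finsetSum_coeff, coeff_monomial]
    rw [Finset.sum_eq_single_of_mem k (mem_range.2 hk) fun j _ hj => if_neg hj, if_pos rfl]
  have hd : X ^ (L + 1) ∣ P s * P t - P (s + t) := by
    rw [X_pow_dvd_iff]
    intro d hd
    rw [coeff_sub, sub_eq_zero, coeff_mul, hc _ _ hd]
    simp only [c]
    rw [Ring.add_choose_eq d (Commute.all s t), Finset.sum_mul, Complex.ofReal_sum]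
    refine Finset.sum_congr rfl fun ij hij => ?_
    have hij' := Finset.HasAntidiagonal.mem_antidiagonal.1 hij
    rw [hc _ _ (by omega), hc _ _ (by omega), ← Complex.ofReal_mul]
    congr 1
    have : s + t - d = (s - ij.1) + (t - ij.2) := by
      rw [← hij']; push_cast; ring
    rw [this, Real.rpow_add hA]
    ring
  obtain ⟨Q, hQ⟩ := hd
  rw [hP, hP, hP, ← map_mul, ← sub_eq_zero, ← map_sub, hQ, map_mul, map_pow, aeval_X,
    soul_pow_eq_zero, zero_mul]

theorem pow_zero_right {A : Ev L} : pow A 0 = 1 := by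
  rw [pow, Finset.sum_range_succ']
  simp [Ring.choose_zero_succ]

theorem pow_one_right {A : Ev L} (hi : (body A).im = 0) : pow A 1 = A := by
  have h1 : ∀ k, Ring.choose (1 : ℝ) k = Nat.choose 1 k := fun k => by
    exact_mod_cast Ring.choose_natCast (R := ℝ) 1 k
  -- The length `L + 2` guarantees that the terms `k = 0` and `k = 1` can be split off even for `L =
  -- 0`.
  rw [pow_eq_sum_range A 1 (M := L + 2) (by omega), Finset.sum_range_succ', Finset.sum_range_succ']
  have : ((body A).re : ℂ) = body A := Complex.ext rfl (by simp [hi])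
  rw [Finset.sum_eq_zero]
  · simp only [h1, zero_add]
    simp only [Nat.choose_self, Nat.choose_zero_right, Nat.cast_one, one_mul, sub_self,
      Real.rpow_zero, Complex.ofReal_one, one_smul, pow_one, Nat.cast_zero, sub_zero,
      Real.rpow_one, pow_zero, this]
    rw [add_comm, ← Algebra.algebraMap_eq_smul_one, body_add_soul]
  · intro k _
    simp [h1, Nat.choose_eq_zero_of_lt (show 1 < k + 1 + 1 by omega)]

theorem body_pow (A : Ev L) (s : ℝ) : body (pow A s) = (((body A).re ^ s : ℝ) : ℂ) := by
  rw [← bodyHom_apply, pow, map_sum, Finset.sum_range_succ', Finset.sum_eq_zero]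
  · rw [zero_add, map_smul, pow_zero, map_one]
    simp
  · intro k _
    rw [map_smul, map_pow, bodyHom_apply, body_soul]
    simp

/-- Real even elements with positive body. -/
def IsPos (A : Ev L) : Prop := conjHom L A = A ∧ 0 < (body A).re

namespace IsPos

variable {A B : Ev L}

theorem body_im (h : IsPos A) : (body A).im = 0 := by
  have := congrArg body h.1
  rw [body_conjHom] at this
  exact Complex.conj_eq_iff_im.1 this

theorem isUnit (h : IsPos A) : IsUnit A := (isUnit_iff A).2 fun h0 => by
  have := h.2; rw [h0] at this; simp at this

theorem mul (hA : IsPos A) (hB : IsPos B) : IsPos (A * B) := by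
  refine ⟨by rw [map_mul, hA.1, hB.1], ?_⟩
  rw [body_mul, Complex.mul_re, hA.body_im, hB.body_im]
  have := mul_pos hA.2 hB.2
  simpa

theorem add (hA : IsPos A) (hB : IsPos B) : IsPos (A + B) :=
  ⟨by rw [map_add, hA.1, hB.1], add_pos hA.2 hB.2⟩

theorem npow (hA : IsPos A) (k : ℕ) : IsPos (A ^ k) := by
  induction k with
  | zero => exact ⟨by simp, by simp [body_one]⟩
  | succ k ih => rw [pow_succ]; exact ih.mul hA

theorem of_mul_eq_one (hA : IsPos A) (h : A * B = 1) : IsPos B := by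
  have hu := hA.isUnit
  refine ⟨hu.mul_left_cancel ?_, ?_⟩
  · rw [h]
    conv_lhs => rw [← hA.1]
    rw [← map_mul, h, map_one]
  · have h1 := congrArg Complex.re (congrArg body h)
    rw [body_mul, body_one, Complex.mul_re, hA.body_im, zero_mul, sub_zero, Complex.one_re] at h1
    exact pos_of_mul_pos_right (h1 ▸ one_pos) hA.2.le

theorem inverse (hA : IsPos A) : IsPos (Ring.inverse A) :=
  hA.of_mul_eq_one (Ring.mul_inverse_cancel _ hA.isUnit)

/-- In `(A + B) (A - B) = 0` the first factor has positive body, hence is a unit. This uniqueness of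
positive roots replaces most manipulations of fractional powers. -/
theorem eq_of_sq_eq (hA : IsPos A) (hB : IsPos B) (h : A ^ 2 = B ^ 2) : A = B := by
  refine sub_eq_zero.1 ((hA.add hB).isUnit.mul_left_cancel ?_)
  rw [mul_zero]
  linear_combination h

theorem conjHom_soul (hA : IsPos A) : conjHom L (soul A) = soul A := by
  have h1 := Complex.conj_eq_iff_im.2 hA.body_im
  rw [soul, map_sub, hA.1, Algebra.algebraMap_eq_smul_one, conjHom_smul, map_one, h1]

theorem pow (hA : IsPos A) (s : ℝ) : IsPos (pow A s) := by
  constructor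
  · rw [Grassmann.pow, map_sum]
    refine Finset.sum_congr rfl fun k _ => ?_
    rw [conjHom_smul, map_pow, hA.conjHom_soul, Complex.conj_ofReal]
  · rw [body_pow, Complex.ofReal_re]
    exact Real.rpow_pos_of_pos hA.2 s

theorem pow_pow_natCast (hA : IsPos A) (s : ℝ) (k : ℕ) :
    Grassmann.pow A s ^ k = Grassmann.pow A (s * k) := by
  induction k with
  | zero => simp [pow_zero_right]
  | succ k ih => rw [pow_succ, ih, pow_mul_pow hA.2]; congr 1; push_cast; ring

/-- The fourth power of the fourth root. -/
theorem pow_quarter (hA : IsPos A) : Grassmann.pow A (1 / 4) ^ 4 = A := by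
  rw [hA.pow_pow_natCast, ← pow_one_right hA.body_im]
  norm_num [pow_one_right hA.body_im]

theorem pow_neg_three_halves (hA : IsPos A) : Grassmann.pow A (-3 / 2) ^ 2 * A ^ 3 = 1 := by
  have h : A ^ 3 = Grassmann.pow A 3 := by
    conv_lhs => rw [← pow_one_right hA.body_im, hA.pow_pow_natCast]
    norm_num
  rw [hA.pow_pow_natCast, h, pow_mul_pow hA.2, ← pow_zero_right (A := A)]
  norm_num

end IsPos

/-! ### Finite dimension and smoothness -/

instance : FiniteDimensional ℂ (Grassmann L) :=
  inferInstanceAs (FiniteDimensional ℂ (Finset (Fin L) → ℂ))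
instance : FiniteDimensional ℂ (Ev L) :=
  inferInstanceAs (FiniteDimensional ℂ (Subalgebra.toSubmodule (evenPart L)))
instance : FiniteDimensional ℂ (Od L) :=
  inferInstanceAs (FiniteDimensional ℂ (oddPart L))
instance : FiniteDimensional ℝ (Ev L) := FiniteDimensional.complexToReal _
instance : FiniteDimensional ℝ (Od L) := FiniteDimensional.complexToReal _
instance : CompleteSpace (Ev L) := FiniteDimensional.complete ℝ (Ev L)

/-- The body, as a continuous real linear map. -/
noncomputable def bodyCLM (L : ℕ) : Ev L →L[ℝ] ℂ :=
  LinearMap.toContinuousLinearMap ((bodyHom L).toLinearMap.restrictScalars ℝ)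

theorem bodyCLM_apply (x : Ev L) : bodyCLM L x = body x := rfl

theorem contDiff_soul : ContDiff ℝ (⊤ : ℕ∞) (soul : Ev L → Ev L) := by
  have : (soul : Ev L → Ev L) = fun x => x - (bodyCLM L x) • (1 : Ev L) := funext fun x => by
    rw [soul, Algebra.algebraMap_eq_smul_one, bodyCLM_apply]
  rw [this]
  exact contDiff_id.sub ((bodyCLM L).contDiff.smul contDiff_const)

theorem contDiffAt_pow {A : Ev L} (hA : 0 < (body A).re) (s : ℝ) :
    ContDiffAt ℝ (⊤ : ℕ∞) (fun A : Ev L => pow A s) A := by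
  unfold pow
  refine ContDiffAt.sum fun k _ => ContDiffAt.fun_smul ?_ (contDiff_soul.contDiffAt.pow k)
  refine Complex.ofRealCLM.contDiff.contDiffAt.comp A (contDiffAt_const.mul ?_)
  have : ContDiffAt ℝ (⊤ : ℕ∞) (fun A : Ev L => (body A).re) A :=
    (Complex.reCLM.comp (bodyCLM L)).contDiff.contDiffAt
  exact this.rpow_const_of_ne hA.ne'

theorem contDiffAt_inverse {A : Ev L} (hA : IsUnit A) :
    ContDiffAt ℝ (⊤ : ℕ∞) (Ring.inverse : Ev L → Ev L) A := by
  obtain ⟨u, rfl⟩ := hA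
  exact contDiffAt_ringInverse ℝ u

end Grassmann

/-! ### Homomorphisms of Grassmann algebras: naturality of body and powers. -/

namespace GrassmannHom

open Grassmann

variable {L L' : ℕ} (φ : GrassmannHom L L')

/-- The homomorphism of even parts. -/
noncomputable def ev : Ev L →ₐ[ℂ] Ev L' where
  toFun x := ⟨φ.toFun x.1, φ.map_ev _ x.2⟩
  map_one' := Ev.ext (map_one φ.toAlgHom)
  map_mul' x y := Ev.ext (map_mul φ.toAlgHom x.1 y.1)
  map_zero' := Ev.ext (map_zero φ.toAlgHom)
  map_add' x y := Ev.ext (map_add φ.toAlgHom x.1 y.1)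
  commutes' c := Ev.ext (φ.toAlgHom.commutes c)

/-- The homomorphism of odd parts. -/
noncomputable def od : Od L →ₗ[ℂ] Od L' where
  toFun x := ⟨φ.toFun x.1, φ.map_od _ x.2⟩
  map_add' x y := Od.ext (map_add φ.toAlgHom x.1 y.1)
  map_smul' c x := Od.ext (map_smul φ.toAlgHom c x.1)

theorem ev_coe (x : Ev L) : ((φ.ev x : Ev L') : Grassmann L') = φ.toFun (x : Grassmann L) := rfl

theorem ev_conjHom (x : Ev L) : φ.ev (conjHom L x) = conjHom L' (φ.ev x) :=
  Ev.ext (φ.map_conj x.1)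

/-- The image of the soul is nilpotent, so its body is a nilpotent complex number, that is, zero. -/
theorem body_ev (x : Ev L) : body (φ.ev x) = body x := by
  have h : body (φ.ev (soul x)) = 0 := by
    have := congrArg (fun z => bodyHom L' (φ.ev z)) (soul_pow_eq_zero x)
    simp only [map_pow, map_zero] at this
    exact pow_eq_zero_iff (Nat.succ_ne_zero L) |>.1 this
  conv_lhs => rw [← body_add_soul x]
  rw [map_add, ← bodyHom_apply, map_add, AlgHom.commutes, AlgHom.commutes, bodyHom_apply, h]
  simp

theorem ev_soul (x : Ev L) : φ.ev (soul x) = soul (φ.ev x) := by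
  rw [soul, soul, map_sub, AlgHom.commutes, body_ev]

theorem ev_pow (A : Ev L) (s : ℝ) : φ.ev (pow A s) = pow (φ.ev A) s := by
  -- The two binomial series are truncated at different lengths; `L + L' + 1` is long enough for
  -- both.
  rw [pow_eq_sum_range A s (M := L + L' + 1) (by omega),
    pow_eq_sum_range (φ.ev A) s (M := L + L' + 1) (by omega), map_sum]
  refine Finset.sum_congr rfl fun k _ => ?_
  rw [map_smul, map_pow, ev_soul, body_ev]

end GrassmannHom

/-! ### Products and conjugates of odd elements. -/

namespace Grassmann

variable {L : ℕ}

theorem algebraMap_smul_od (z : ℂ) (x : Od L) : (algebraMap ℂ (Ev L) z) • x = z • x :=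
  Od.ext (by
    change algebraMap ℂ (Grassmann L) z * (x : Grassmann L) = z • (x : Grassmann L)
    rw [Algebra.smul_def])

theorem odMul_add_left (x x' y : Od L) : odMul (x + x') y = odMul x y + odMul x' y :=
  Ev.ext (add_mul (x : Grassmann L) x' y)

theorem odMul_add_right (x y y' : Od L) : odMul x (y + y') = odMul x y + odMul x y' :=
  Ev.ext (mul_add (x : Grassmann L) y y')

theorem odMul_smul_left (c : Ev L) (x y : Od L) : odMul (c • x) y = c * odMul x y :=
  Ev.ext (mul_assoc (c : Grassmann L) x y)

theorem odMul_smul_right (c : Ev L) (x y : Od L) : odMul x (c • y) = c * odMul x y :=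
  Ev.ext (by
    change (x : Grassmann L) * ((c : Grassmann L) * y) = (c : Grassmann L) * (x * y)
    rw [← mul_assoc, ← ev_mul_comm c.2, mul_assoc])

theorem conjOd_add (x y : Od L) : conjOd (x + y) = conjOd x + conjOd y :=
  Od.ext (map_add conj (x : Grassmann L) y)

theorem conjOd_smul (c : Ev L) (x : Od L) : conjOd (c • x) = conjHom L c • conjOd x :=
  Od.ext (map_mul conj (c : Grassmann L) x)

theorem conjOd_conjOd (x : Od L) : conjOd (conjOd x) = x :=
  Od.ext (ext fun _ => Complex.conj_conj _)

theorem conjHom_odMul (x y : Od L) : conjHom L (odMul x y) = odMul (conjOd x) (conjOd y) :=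
  Ev.ext (map_mul conj (x : Grassmann L) y)

/-- Exchanging `S` with its complement in `U` matches the terms of the two products. Only pairs of
odd sets contribute, and for these the sign of the exchange is `-1` because the product of the
cardinalities is odd. -/
theorem odMul_comm (x y : Od L) : odMul x y = -odMul y x := by
  refine Ev.ext (ext fun U => ?_)
  change ((x : Grassmann L) * (y : Grassmann L)) U = -((y : Grassmann L) * (x : Grassmann L)) U
  rw [mul_apply, mul_apply, ← Finset.sum_neg_distrib]
  refine Finset.sum_bij' (fun S _ => U \ S) (fun S _ => U \ S) ?_ ?_ ?_ ?_ ?_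
  · intro S _; simp
  · intro S _; simp
  · intro S hS; exact Finset.sdiff_sdiff_eq_self (Finset.mem_powerset.1 hS)
  · intro S hS; exact Finset.sdiff_sdiff_eq_self (Finset.mem_powerset.1 hS)
  · intro S hS
    simp only [Finset.sdiff_sdiff_eq_self (Finset.mem_powerset.1 hS)]
    by_cases h : Even S.card
    · simp [x.2 _ h]
    by_cases h' : Even (U \ S).card
    · simp [y.2 _ h']
    rw [sgn_swap (Finset.disjoint_sdiff (s := S) (t := U)), Odd.neg_one_pow]
    · ring
    · exact (Nat.not_even_iff_odd.1 h).mul (Nat.not_even_iff_odd.1 h')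

theorem body_odMul (x y : Od L) : body (odMul x y) = 0 := by
  change ((x : Grassmann L) * (y : Grassmann L)) ∅ = 0
  have : (x : Grassmann L) ∅ = 0 := x.2 ∅ (by simp)
  simp [mul_apply, this]

end Grassmann

/-! ### Scalars and base change for points of superspaces. -/

namespace SVec

open Grassmann

variable {ι : Type} {p L L' : ℕ}

theorem algebraMap_smul (z : ℂ) (v : SVec ι p L) : (algebraMap ℂ (Ev L) z) • v = z • v :=
  Prod.ext (funext fun _ => (Algebra.smul_def _ _).symm)
    (funext fun _ => algebraMap_smul_od _ _)

variable (φ : GrassmannHom L L')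

theorem map_fst (v : SVec ι p L) (a : ι) : (v.map φ).1 a = φ.ev (v.1 a) := rfl

theorem map_snd (v : SVec ι p L) (j : Fin p) : (v.map φ).2 j = φ.od (v.2 j) := rfl

theorem map_add (v v' : SVec ι p L) : (v + v').map φ = v.map φ + v'.map φ :=
  Prod.ext (funext fun _ => _root_.map_add φ.ev _ _) (funext fun _ => _root_.map_add φ.od _ _)

theorem map_smul (c : Ev L) (v : SVec ι p L) : (c • v).map φ = φ.ev c • v.map φ :=
  Prod.ext (funext fun _ => _root_.map_mul φ.ev _ _)
    (funext fun _ => Od.ext (_root_.map_mul φ.toAlgHom c.1 _))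

theorem ev_odMul (x y : Od L) : φ.ev (odMul x (conjOd y)) = odMul (φ.od x) (conjOd (φ.od y)) := by
  refine Ev.ext ?_
  change φ.toAlgHom (_ * _) = φ.toAlgHom _ * conj (φ.toAlgHom _)
  rw [_root_.map_mul]
  congr 1
  exact φ.map_conj _

end SVec

/-! ### The Hermitian pairing. -/

section

attribute [local irreducible] Grassmann.instNormedCommRingEv

namespace SVec

open Grassmann

variable {ι : Type} {p L L' : ℕ}

theorem smul_smul_comm (z : ℂ) (c : Ev L) (v : SVec ι p L) : (z • c) • v = z • c • v := by
  rw [← algebraMap_smul, ← mul_smul, Algebra.smul_def]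

theorem real_smul_smul (r : ℝ) (c : Ev L) (v : SVec ι p L) : (r • c) • v = r • c • v :=
  smul_smul_comm (r : ℂ) c v

theorem smul_real_smul (r : ℝ) (c : Ev L) (v : SVec ι p L) : c • r • v = r • c • v := by
  change c • (r : ℂ) • v = (r : ℂ) • c • v
  rw [← algebraMap_smul, smul_smul, mul_comm, mul_smul, algebraMap_smul]

theorem isNonzero_smul {v : SVec ι p L} {c : Ev L} (hc : IsUnit c) (hv : v.IsNonzero) :
    (c • v).IsNonzero := by
  obtain ⟨a, ha⟩ := hv
  refine ⟨a, ?_⟩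
  change body (c * v.1 a) ≠ 0
  rw [body_mul]
  exact mul_ne_zero ((isUnit_iff c).1 hc) ha

variable [Fintype ι] {τ : ℂ}

theorem herm_add_left (u v v' : SVec ι p L) : (u + v).herm τ v' = u.herm τ v' + v.herm τ v' := by
  simp only [herm, Prod.fst_add, Prod.snd_add, Pi.add_apply, add_mul, odMul_add_left,
    Finset.sum_add_distrib, smul_add]
  abel

theorem herm_add_right (u v v' : SVec ι p L) : u.herm τ (v + v') = u.herm τ v + u.herm τ v' := by
  simp only [herm, Prod.fst_add, Prod.snd_add, Pi.add_apply, mul_add, odMul_add_right, conjEv_eq,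
    _root_.map_add, conjOd_add, Finset.sum_add_distrib, smul_add]
  abel

theorem herm_smul_left (c : Ev L) (v v' : SVec ι p L) : (c • v).herm τ v' = c * v.herm τ v' := by
  simp only [herm, Prod.smul_fst, Prod.smul_snd, Pi.smul_apply, smul_eq_mul, odMul_smul_left,
    mul_assoc, ← Finset.mul_sum, mul_add, mul_smul_comm]

theorem herm_smul_right (c : Ev L) (v v' : SVec ι p L) :
    v.herm τ (c • v') = conjHom L c * v.herm τ v' := by
  simp only [herm, Prod.smul_fst, Prod.smul_snd, Pi.smul_apply, smul_eq_mul, odMul_smul_right,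
    conjOd_smul, conjEv_eq, _root_.map_mul, mul_left_comm _ (conjHom L c), ← Finset.mul_sum,
    mul_add, mul_smul_comm]

theorem herm_real_smul_left (r : ℝ) (v v' : SVec ι p L) : (r • v).herm τ v' = r • v.herm τ v' := by
  change ((r : ℂ) • v).herm τ v' = (r : ℂ) • v.herm τ v'
  rw [← algebraMap_smul, herm_smul_left, Algebra.smul_def]

theorem herm_real_smul_right (r : ℝ) (v v' : SVec ι p L) :
    v.herm τ (r • v') = r • v.herm τ v' := by
  change v.herm τ ((r : ℂ) • v') = (r : ℂ) • v.herm τ v'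
  rw [← algebraMap_smul, herm_smul_right, Algebra.algebraMap_eq_smul_one, conjHom_smul,
    Complex.conj_ofReal, map_one, smul_mul_assoc, one_mul]

/-- Conjugation keeps the order of products, so restoring the order of two odd factors costs a sign;
it is compensated by `τ̄ = -τ`. -/
theorem conjHom_herm (hτ : τ = Complex.I ∨ τ = -Complex.I) (v v' : SVec ι p L) :
    conjHom L (v.herm τ v') = v'.herm τ v := by
  have h : starRingEnd ℂ τ = -τ := by rcases hτ with rfl | rfl <;> simp
  simp only [herm, _root_.map_add, map_sum, _root_.map_mul, conjHom_smul, conjEv_eq, h,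
    conjHom_conjHom, conjHom_odMul, conjOd_conjOd]
  congr 1
  · exact Finset.sum_congr rfl fun a _ => mul_comm _ _
  · rw [neg_smul, ← smul_neg, ← Finset.sum_neg_distrib]
    congr 1
    exact Finset.sum_congr rfl fun j _ => by rw [odMul_comm (v'.2 j)]

/-- Products of odd elements have no body, so the body is the sum of the `|body vᵃ|²` over the even
coordinates. -/
theorem isPos_herm_self (hτ : τ = Complex.I ∨ τ = -Complex.I) {v : SVec ι p L}
    (hv : v.IsNonzero) : IsPos (v.herm τ v) := by
  refine ⟨conjHom_herm hτ v v, ?_⟩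
  have h : body (v.herm τ v) = ∑ a, ((Complex.normSq (body (v.1 a)) : ℝ) : ℂ) := by
    rw [← bodyHom_apply, herm, _root_.map_add, _root_.map_smul, map_sum, map_sum]
    simp only [bodyHom_apply, body_odMul, body_mul, conjEv_eq, body_conjHom, Complex.mul_conj]
    simp
  obtain ⟨a, ha⟩ := hv
  rw [h, ← Complex.ofReal_sum, Complex.ofReal_re]
  exact Finset.sum_pos' (fun _ _ => Complex.normSq_nonneg _)
    ⟨a, Finset.mem_univ _, Complex.normSq_pos.2 ha⟩

theorem ev_herm (φ : GrassmannHom L L') (v v' : SVec ι p L) :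
    φ.ev (v.herm τ v') = (v.map φ).herm τ (v'.map φ) := by
  simp only [herm, _root_.map_add, map_sum, _root_.map_mul, _root_.map_smul, conjEv_eq,
    φ.ev_conjHom, map_fst]
  simp only [ev_odMul, map_snd]

/-- The Hermitian pairing, as a continuous real bilinear map. -/
noncomputable def hermL (τ : ℂ) (ι : Type) [Fintype ι] (p L : ℕ) :
    SVec ι p L →L[ℝ] SVec ι p L →L[ℝ] Ev L :=
  (LinearMap.mk₂ ℝ (herm τ) herm_add_left herm_real_smul_left herm_add_right
    herm_real_smul_right).toContinuousBilinearMap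

theorem hermL_apply (v v' : SVec ι p L) : hermL τ ι p L v v' = v.herm τ v' := rfl

/-- Multiplication by even elements, as a continuous real bilinear map. -/
noncomputable def smulL (ι : Type) [Fintype ι] (p L : ℕ) :
    Ev L →L[ℝ] SVec ι p L →L[ℝ] SVec ι p L :=
  (LinearMap.mk₂ ℝ (fun (c : Ev L) (v : SVec ι p L) => c • v) add_smul real_smul_smul smul_add
    smul_real_smul).toContinuousBilinearMap

end SVec

end

/-! ### Algebra of the explicit form: weight, bracket and their invariance. -/

section

attribute [local irreducible] Grassmann.instNormedCommRingEv

namespace WeightedProj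

open Grassmann SVec

variable {n p m q L L' : ℕ} {τ : ℂ}

theorem half_smul (z : Ev L) : (1 / 2 : ℝ) • z = algebraMap ℝ (Ev L) (1 / 2) * z :=
  Algebra.smul_def _ _

theorem two_mul_half : 2 * algebraMap ℝ (Ev L) (1 / 2) = 1 := by
  rw [← map_ofNat (algebraMap ℝ (Ev L)) 2, ← map_mul, ← map_one (algebraMap ℝ (Ev L))]
  norm_num

theorem conjHom_algebraMap (r : ℝ) :
    conjHom L (algebraMap ℝ (Ev L) r) = algebraMap ℝ (Ev L) r := by
  rw [Algebra.algebraMap_eq_smul_one, conjHom_real_smul, map_one]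

theorem complex_smul_mul (z : ℂ) (c x : Ev L) : c * z • x = z • (c * x) := mul_smul_comm z c x

/-- The first factor `(v v̄)^{-3/2} (w w̄)^{-3/2}` of the explicit form. -/
noncomputable def weight (τ : ℂ) (x : Pt n p m q L) : Ev L :=
  Grassmann.pow (x.1.herm τ x.1) (-3 / 2) * Grassmann.pow (x.2.herm τ x.2) (-3 / 2)

/-- The second factor of the explicit form. -/
noncomputable def bracket (τ : ℂ) (x X Y : Pt n p m q L) : Ev L :=
  let A := x.1.herm τ x.1
  let B := x.2.herm τ x.2
  A * B ^ 2 * (X.1.herm τ Y.1 - Y.1.herm τ X.1) + A ^ 2 * B * (X.2.herm τ Y.2 - Y.2.herm τ X.2)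
    - algebraMap ℝ (Ev L) (1 / 2) *
      (B ^ 2 * (X.1.herm τ x.1 * x.1.herm τ Y.1 - Y.1.herm τ x.1 * x.1.herm τ X.1)
      + A ^ 2 * (X.2.herm τ x.2 * x.2.herm τ Y.2 - Y.2.herm τ x.2 * x.2.herm τ X.2)
      - A * B * (X.2.herm τ x.2 * x.1.herm τ Y.1 - Y.2.herm τ x.2 * x.1.herm τ X.1)
      - A * B * (X.1.herm τ x.1 * x.2.herm τ Y.2 - Y.1.herm τ x.1 * x.2.herm τ X.2))

theorem explicitForm_eq (x X Y : Pt n p m q L) :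
    explicitForm τ x X Y = (Complex.I / 2) • (weight τ x * bracket τ x X Y) := by
  simp only [explicitForm, half_smul, weight, bracket, dd, wedge]
  congr 1
  ring

theorem bracket_add_left (x X X' Y : Pt n p m q L) :
    bracket τ x (X + X') Y = bracket τ x X Y + bracket τ x X' Y := by
  simp only [bracket, Prod.fst_add, Prod.snd_add, herm_add_left, herm_add_right]
  ring

theorem bracket_swap (x X Y : Pt n p m q L) : bracket τ x X Y = -bracket τ x Y X := by
  simp only [bracket]
  ring

theorem bracket_smul_left {c : Ev L} (hc : conjHom L c = c) (x X Y : Pt n p m q L) :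
    bracket τ x (c • X) Y = c * bracket τ x X Y := by
  simp only [bracket, Prod.smul_fst, Prod.smul_snd, herm_smul_left, herm_smul_right, hc]
  ring

/-- The explicit form vanishes on the vectors that are tangent to the orbits of `ℂ*`. -/
theorem bracket_vertical (c : Ev L) (x Y : Pt n p m q L) :
    bracket τ x (c • x.1, (-c) • x.2) Y = 0 := by
  simp only [bracket, herm_smul_left, herm_smul_right, map_neg]
  -- On a vertical vector the four products of 1-forms add up to twice the two leading terms, so the
  -- factor `1 / 2` makes everything cancel.
  linear_combination (-(x.1.herm τ x.1 * x.2.herm τ x.2) *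
    (x.2.herm τ x.2 * (c * x.1.herm τ Y.1 - conjHom L c * Y.1.herm τ x.1)
      - x.1.herm τ x.1 * (c * x.2.herm τ Y.2 - conjHom L c * Y.2.herm τ x.2))) *
    two_mul_half (L := L)

/-- Every monomial of the bracket contains exactly two pairings on `V` and two on `W`, so the action
multiplies it by `(g h ḡ h̄)² = 1`. -/
theorem bracket_act {g h : Ev L} (hgh : g * h = 1) (x X Y : Pt n p m q L) :
    bracket τ (g • x.1, h • x.2) (g • X.1, h • X.2) (g • Y.1, h • Y.2) = bracket τ x X Y := by
  have h1 : conjHom L g * conjHom L h = 1 := by rw [← map_mul, hgh, map_one]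
  have h2 : bracket τ (g • x.1, h • x.2) (g • X.1, h • X.2) (g • Y.1, h • Y.2) =
      ((g * h) * (conjHom L g * conjHom L h)) ^ 2 * bracket τ x X Y := by
    simp only [bracket, herm_smul_left, herm_smul_right]
    ring
  rw [h2, hgh, h1]
  ring

theorem isPos_fst (hτ : τ = Complex.I ∨ τ = -Complex.I) {x : Pt n p m q L}
    (hx : x ∈ X₀ n p m q L) : IsPos (x.1.herm τ x.1) := isPos_herm_self hτ hx.1

theorem isPos_snd (hτ : τ = Complex.I ∨ τ = -Complex.I) {x : Pt n p m q L}
    (hx : x ∈ X₀ n p m q L) : IsPos (x.2.herm τ x.2) := isPos_herm_self hτ hx.2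

theorem isPos_weight (hτ : τ = Complex.I ∨ τ = -Complex.I) {x : Pt n p m q L}
    (hx : x ∈ X₀ n p m q L) : IsPos (weight τ x) :=
  ((isPos_fst hτ hx).pow _).mul ((isPos_snd hτ hx).pow _)

theorem weight_sq (hτ : τ = Complex.I ∨ τ = -Complex.I) {x : Pt n p m q L}
    (hx : x ∈ X₀ n p m q L) :
    weight τ x ^ 2 * (x.1.herm τ x.1 * x.2.herm τ x.2) ^ 3 = 1 := by
  have h1 := (isPos_fst hτ hx).pow_neg_three_halves
  have h2 := (isPos_snd hτ hx).pow_neg_three_halves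
  rw [weight]
  linear_combination Grassmann.pow (x.2.herm τ x.2) (-3 / 2) ^ 2 * (x.2.herm τ x.2) ^ 3 * h1 + h2

/-- The weight is the only positive root of its defining equation. -/
theorem eq_weight (hτ : τ = Complex.I ∨ τ = -Complex.I) {x : Pt n p m q L}
    (hx : x ∈ X₀ n p m q L) {P : Ev L} (hP : IsPos P)
    (h : P ^ 2 * (x.1.herm τ x.1 * x.2.herm τ x.2) ^ 3 = 1) : P = weight τ x := by
  refine hP.eq_of_sq_eq (isPos_weight hτ hx) ?_
  refine (((isPos_fst hτ hx).mul (isPos_snd hτ hx)).npow 3).isUnit.mul_right_cancel ?_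
  rw [h, weight_sq hτ hx]

theorem act_mem_X₀ {g h : Ev L} (hgh : g * h = 1) {x : Pt n p m q L} (hx : x ∈ X₀ n p m q L) :
    ((g • x.1, h • x.2) : Pt n p m q L) ∈ X₀ n p m q L :=
  ⟨isNonzero_smul (IsUnit.of_mul_eq_one h hgh) hx.1,
    isNonzero_smul (IsUnit.of_mul_eq_one g ((mul_comm h g).trans hgh)) hx.2⟩

/-- The product `A B` is invariant, so both weights are positive roots of the same equation, and
`eq_weight` applies. -/
theorem weight_act (hτ : τ = Complex.I ∨ τ = -Complex.I) {g h : Ev L} (hgh : g * h = 1)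
    {x : Pt n p m q L} (hx : x ∈ X₀ n p m q L) :
    weight τ (g • x.1, h • x.2) = weight τ x := by
  refine eq_weight hτ hx (isPos_weight hτ (act_mem_X₀ hgh hx)) ?_
  have h1 : conjHom L g * conjHom L h = 1 := by rw [← map_mul, hgh, map_one]
  have h2 := weight_sq hτ (act_mem_X₀ hgh hx)
  simp only [herm_smul_left, herm_smul_right] at h2
  rw [← h2]
  have h3 : ∀ P A B : Ev L, P ^ 2 * ((conjHom L g * (g * A)) * (conjHom L h * (h * B))) ^ 3 =
      ((g * h) * (conjHom L g * conjHom L h)) ^ 3 * (P ^ 2 * (A * B) ^ 3) := fun P A B => by ring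
  rw [h3, hgh, h1]
  ring

/-! ### The map `s` -/

/-- The factor `λ` in the map `s`. -/
noncomputable def lam (τ : ℂ) (x : Pt n p m q L) : Ev L :=
  Grassmann.pow (x.2.herm τ x.2 * Ring.inverse (x.1.herm τ x.1)) (1 / 4)

theorem s_eq (x : Pt n p m q L) :
    WeightedProj.s τ x = (lam τ x • x.1, Ring.inverse (lam τ x) • x.2) := rfl

theorem isPos_lam (hτ : τ = Complex.I ∨ τ = -Complex.I) {x : Pt n p m q L}
    (hx : x ∈ X₀ n p m q L) : IsPos (lam τ x) :=
  ((isPos_snd hτ hx).mul (isPos_fst hτ hx).inverse).pow _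

theorem lam_mul_inverse (hτ : τ = Complex.I ∨ τ = -Complex.I) {x : Pt n p m q L}
    (hx : x ∈ X₀ n p m q L) : lam τ x * Ring.inverse (lam τ x) = 1 :=
  Ring.mul_inverse_cancel _ (isPos_lam hτ hx).isUnit

theorem lam_pow_four (hτ : τ = Complex.I ∨ τ = -Complex.I) {x : Pt n p m q L}
    (hx : x ∈ X₀ n p m q L) : lam τ x ^ 4 * x.1.herm τ x.1 = x.2.herm τ x.2 := by
  rw [lam, ((isPos_snd hτ hx).mul (isPos_fst hτ hx).inverse).pow_quarter, mul_assoc,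
    Ring.inverse_mul_cancel _ (isPos_fst hτ hx).isUnit, mul_one]

/-- Both sides are positive with square `B / A`. This and its companion for `λ⁻²` identify the
coefficients of `dv dv̄` and `dw dw̄` in `s^* ω₀` with those of the explicit form. -/
theorem weight_mul_eq_lam_sq (hτ : τ = Complex.I ∨ τ = -Complex.I) {x : Pt n p m q L}
    (hx : x ∈ X₀ n p m q L) :
    weight τ x * (x.1.herm τ x.1 * x.2.herm τ x.2 ^ 2) = lam τ x ^ 2 := by
  refine ((isPos_weight hτ hx).mul ((isPos_fst hτ hx).mul ((isPos_snd hτ hx).npow 2))).eq_of_sq_eq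
    ((isPos_lam hτ hx).npow 2) ?_
  refine (isPos_fst hτ hx).isUnit.mul_right_cancel ?_
  linear_combination x.2.herm τ x.2 * weight_sq hτ hx - lam_pow_four hτ hx

theorem weight_mul_eq_inverse_lam_sq (hτ : τ = Complex.I ∨ τ = -Complex.I) {x : Pt n p m q L}
    (hx : x ∈ X₀ n p m q L) :
    weight τ x * (x.1.herm τ x.1 ^ 2 * x.2.herm τ x.2) = Ring.inverse (lam τ x) ^ 2 := by
  refine ((isPos_weight hτ hx).mul (((isPos_fst hτ hx).npow 2).mul (isPos_snd hτ hx))).eq_of_sq_eq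
    ((isPos_lam hτ hx).inverse.npow 2) ?_
  refine (isPos_snd hτ hx).isUnit.mul_right_cancel ?_
  have h1 : lam τ x ^ 4 * Ring.inverse (lam τ x) ^ 4 = 1 := by
    rw [← mul_pow, lam_mul_inverse hτ hx, one_pow]
  linear_combination x.1.herm τ x.1 * weight_sq hτ hx + Ring.inverse (lam τ x) ^ 4 *
    lam_pow_four hτ hx - x.1.herm τ x.1 * h1

theorem s_mem_X₀ (hτ : τ = Complex.I ∨ τ = -Complex.I) {x : Pt n p m q L}
    (hx : x ∈ X₀ n p m q L) : WeightedProj.s τ x ∈ X₀ n p m q L :=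
  act_mem_X₀ (lam_mul_inverse hτ hx) hx

theorem proj_s (hτ : τ = Complex.I ∨ τ = -Complex.I) {x : Pt n p m q L}
    (hx : x ∈ X₀ n p m q L) : proj (WeightedProj.s τ x) = proj x := by
  obtain ⟨u, hu⟩ := (isPos_lam hτ hx).isUnit
  refine (Quotient.sound ⟨u, ?_⟩ : proj x = proj (WeightedProj.s τ x)).symm
  rw [s_eq, ← hu, Ring.inverse_unit]

/-- Since `λ` is real, `s` changes `A` to `λ² A` and `B` to `λ⁻² B`, and these agree by `λ⁴ A = B`.
-/
theorem ham_s (hτ : τ = Complex.I ∨ τ = -Complex.I) {x : Pt n p m q L}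
    (hx : x ∈ X₀ n p m q L) : ham τ (WeightedProj.s τ x) = 0 := by
  simp only [ham, s_eq, herm_smul_left, herm_smul_right, (isPos_lam hτ hx).1,
    (isPos_lam hτ hx).inverse.1]
  rw [← lam_pow_four hτ hx]
  have h1 := lam_mul_inverse hτ hx
  have h2 : lam τ x ^ 2 * Ring.inverse (lam τ x) ^ 2 = 1 := by rw [← mul_pow, h1, one_pow]
  rw [show lam τ x * (lam τ x * x.1.herm τ x.1) - Ring.inverse (lam τ x) *
    (Ring.inverse (lam τ x) * (lam τ x ^ 4 * x.1.herm τ x.1)) = 0 by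
      linear_combination -(lam τ x ^ 2 * x.1.herm τ x.1) * h2, smul_zero]

/-- The derivative `d` of `l`, where `l ^ 4 A = B`. -/
theorem deriv_fourth_root {R : Type*} [CommRing R] {l k e W A B a b d : R} (hA : IsUnit A)
    (he : 2 * e = 1) (hlk : l * k = 1) (h1 : W * (A * B ^ 2) = l ^ 2)
    (h2 : W * (A ^ 2 * B) = k ^ 2) (hd : 4 * l ^ 3 * d * A + l ^ 4 * a = b) :
    d = k * (W * e ^ 2 * (A * B * b - B ^ 2 * a)) := by
  refine hA.mul_left_cancel ?_
  -- Multiplying `hd` by `e² k³`, with `e = 1/2` and `k = l⁻¹`, isolates `A d`; then `h1` and `h2`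
  -- trade `l²` and `k²` for the weight.
  linear_combination -(A * d * (2 * e + 1)) * he
    - (4 * e ^ 2 * A * d * (l ^ 2 * k ^ 2 + l * k + 1) + e ^ 2 * a * l ^ 2 * k * (l * k + 1)) * hlk
    + e ^ 2 * k ^ 3 * hd - e ^ 2 * k * b * h2 + e ^ 2 * k * a * h1

/-- The pullback of `ω₀` by a map `(v, w) ↦ (l v, l⁻¹ w)`, in terms of the derivative of `l`. -/
theorem omega_scaled (hτ : τ = Complex.I ∨ τ = -Complex.I) {x : Pt n p m q L}
    (hx : x ∈ X₀ n p m q L) (X Y : Pt n p m q L) {dX dY : Ev L}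
    (hX : 4 * lam τ x ^ 3 * dX * x.1.herm τ x.1 +
      lam τ x ^ 4 * (X.1.herm τ x.1 + x.1.herm τ X.1) = X.2.herm τ x.2 + x.2.herm τ X.2)
    (hY : 4 * lam τ x ^ 3 * dY * x.1.herm τ x.1 +
      lam τ x ^ 4 * (Y.1.herm τ x.1 + x.1.herm τ Y.1) = Y.2.herm τ x.2 + x.2.herm τ Y.2) :
    ω₀ τ (lam τ x • X.1 + dX • x.1,
        Ring.inverse (lam τ x) • X.2 + (-(Ring.inverse (lam τ x) ^ 2 * dX)) • x.2)
      (lam τ x • Y.1 + dY • x.1,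
        Ring.inverse (lam τ x) • Y.2 + (-(Ring.inverse (lam τ x) ^ 2 * dY)) • x.2) =
      explicitForm τ x X Y := by
  have hl := (isPos_lam hτ hx).1
  have hm := (isPos_lam hτ hx).inverse.1
  have h1 := lam_mul_inverse hτ hx
  have hA := weight_mul_eq_lam_sq hτ hx
  have hB := weight_mul_eq_inverse_lam_sq hτ hx
  have h4 := lam_pow_four hτ hx
  have he := two_mul_half (L := L)
  -- The derivative of `λ` is real, so it leaves either slot of the pairing unchanged; `λ dλ` and
  -- `λ⁻³ dλ` are the combinations in which it enters the pulled-back form.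
  have key : ∀ Z : Pt n p m q L, ∀ d : Ev L, 4 * lam τ x ^ 3 * d * x.1.herm τ x.1 +
      lam τ x ^ 4 * (Z.1.herm τ x.1 + x.1.herm τ Z.1) = Z.2.herm τ x.2 + x.2.herm τ Z.2 →
      conjHom L d = d ∧ lam τ x * d = weight τ x * algebraMap ℝ (Ev L) (1 / 2) ^ 2 *
        (x.1.herm τ x.1 * x.2.herm τ x.2 * (Z.2.herm τ x.2 + x.2.herm τ Z.2)
        - x.2.herm τ x.2 ^ 2 * (Z.1.herm τ x.1 + x.1.herm τ Z.1)) ∧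
      Ring.inverse (lam τ x) ^ 3 * d = weight τ x * algebraMap ℝ (Ev L) (1 / 2) ^ 2 *
        (x.1.herm τ x.1 ^ 2 * (Z.2.herm τ x.2 + x.2.herm τ Z.2)
        - x.1.herm τ x.1 * x.2.herm τ x.2 * (Z.1.herm τ x.1 + x.1.herm τ Z.1)) := by
    intro Z d hd
    have h := deriv_fourth_root (isPos_fst hτ hx).isUnit he h1 hA hB hd
    have hk4 : Ring.inverse (lam τ x) ^ 4 * x.2.herm τ x.2 = x.1.herm τ x.1 := by
      rw [← h4, ← mul_assoc, ← mul_pow, mul_comm (Ring.inverse _), h1, one_pow, one_mul]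
    refine ⟨?_, ?_, ?_⟩
    · rw [h]
      simp only [map_mul, map_sub, _root_.map_add, map_pow, conjHom_herm hτ, conjHom_algebraMap, hm,
        (isPos_weight hτ hx).1]
      ring
    · rw [h, ← mul_assoc, h1, one_mul]
    · rw [h]
      linear_combination weight τ x * algebraMap ℝ (Ev L) (1 / 2) ^ 2 *
        (x.1.herm τ x.1 * (Z.2.herm τ x.2 + x.2.herm τ Z.2)
        - x.2.herm τ x.2 * (Z.1.herm τ x.1 + x.1.herm τ Z.1)) * hk4
  obtain ⟨hcX, hlX, hmX⟩ := key X dX hX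
  obtain ⟨hcY, hlY, hmY⟩ := key Y dY hY
  rw [explicitForm_eq, ω₀, dd, dd]
  congr 1
  simp only [bracket, herm_add_left, herm_add_right, herm_smul_left, herm_smul_right, map_neg,
    map_mul, map_pow, hl, hm, hcX, hcY]
  -- The terms with `dX * dY` drop out by antisymmetry. What is left is linear in `λ dλ` and `λ⁻³
  -- dλ`, and `he` lowers the factor `(1/2)²` from `key` to `1/2`.
  linear_combination (-(X.1.herm τ Y.1 - Y.1.herm τ X.1)) * hA
    - (X.2.herm τ Y.2 - Y.2.herm τ X.2) * hB
    + (X.1.herm τ x.1 - x.1.herm τ X.1) * hlY - (Y.1.herm τ x.1 - x.1.herm τ Y.1) * hlX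
    - (X.2.herm τ x.2 - x.2.herm τ X.2) * hmY + (Y.2.herm τ x.2 - x.2.herm τ Y.2) * hmX
    - weight τ x * algebraMap ℝ (Ev L) (1 / 2) * (x.2.herm τ x.2 ^ 2 *
        (X.1.herm τ x.1 * x.1.herm τ Y.1 - Y.1.herm τ x.1 * x.1.herm τ X.1)
      + x.1.herm τ x.1 ^ 2 *
        (X.2.herm τ x.2 * x.2.herm τ Y.2 - Y.2.herm τ x.2 * x.2.herm τ X.2)
      - x.1.herm τ x.1 * x.2.herm τ x.2 *
        (X.2.herm τ x.2 * x.1.herm τ Y.1 - Y.2.herm τ x.2 * x.1.herm τ X.1)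
      - x.1.herm τ x.1 * x.2.herm τ x.2 *
        (X.1.herm τ x.1 * x.2.herm τ Y.2 - Y.1.herm τ x.1 * x.2.herm τ X.2)) * he

end WeightedProj

end

/-! ### Openness, derivatives and smoothness in homogeneous coordinates. -/

section

attribute [local irreducible] Grassmann.instNormedCommRingEv

namespace SVec

open Grassmann

variable {ι : Type} {p L : ℕ} {τ : ℂ}

theorem isOpen_isNonzero [Finite ι] : IsOpen {v : SVec ι p L | v.IsNonzero} := by
  have h : {v : SVec ι p L | v.IsNonzero} = ⋃ a, (fun v => bodyCLM L (v.1 a)) ⁻¹' {0}ᶜ := by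
    ext v
    simp [IsNonzero, bodyCLM_apply]
  rw [h]
  exact isOpen_iUnion fun a => isOpen_compl_singleton.preimage <|
    (bodyCLM L).continuous.comp ((continuous_apply a).comp continuous_fst)

variable [Fintype ι]

theorem hasFDerivAt_herm_self (v : SVec ι p L) :
    HasFDerivAt (fun v : SVec ι p L => v.herm τ v)
      ((hermL τ ι p L v) + (hermL τ ι p L).flip v) v := by
  have h := (hermL τ ι p L).hasFDerivAt_of_bilinear (hasFDerivAt_id v) (hasFDerivAt_id v)
  refine h.congr_fderiv (ContinuousLinearMap.ext fun X => ?_)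
  simp

theorem contDiff_herm_self : ContDiff ℝ (⊤ : ℕ∞) (fun v : SVec ι p L => v.herm τ v) :=
  (hermL τ ι p L).isBoundedBilinearMap.contDiff.comp (contDiff_id.prodMk contDiff_id)

end SVec

namespace WeightedProj

open Grassmann SVec

variable {n p m q L L' : ℕ} {τ : ℂ}

theorem isOpen_X₀ : IsOpen (X₀ n p m q L) :=
  (isOpen_isNonzero.preimage continuous_fst).inter (isOpen_isNonzero.preimage continuous_snd)

theorem isOpen_target (a : Fin n) : IsOpen (target (p := p) (m := m) (q := q) (L := L) a) :=
  isOpen_isNonzero.preimage continuous_snd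

theorem hasFDerivAt_fst_herm (x : Pt n p m q L) :
    ∃ A' : Pt n p m q L →L[ℝ] Ev L, HasFDerivAt (fun x : Pt n p m q L => x.1.herm τ x.1) A' x ∧
      ∀ X, A' X = X.1.herm τ x.1 + x.1.herm τ X.1 :=
  ⟨_, (hasFDerivAt_herm_self x.1).comp x hasFDerivAt_fst, fun X => by
    simp [hermL_apply, add_comm]⟩

theorem hasFDerivAt_snd_herm (x : Pt n p m q L) :
    ∃ B' : Pt n p m q L →L[ℝ] Ev L, HasFDerivAt (fun x : Pt n p m q L => x.2.herm τ x.2) B' x ∧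
      ∀ X, B' X = X.2.herm τ x.2 + x.2.herm τ X.2 :=
  ⟨_, (hasFDerivAt_herm_self x.2).comp x hasFDerivAt_snd, fun X => by
    simp [hermL_apply, add_comm]⟩

theorem contDiff_fst_herm : ContDiff ℝ (⊤ : ℕ∞) (fun x : Pt n p m q L => x.1.herm τ x.1) :=
  contDiff_herm_self.comp contDiff_fst

theorem contDiff_snd_herm : ContDiff ℝ (⊤ : ℕ∞) (fun x : Pt n p m q L => x.2.herm τ x.2) :=
  contDiff_herm_self.comp contDiff_snd

theorem fderiv_ham (x X : Pt n p m q L) : fderiv ℝ (ham τ) x X =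
    (1 / 2 : ℝ) • ((X.1.herm τ x.1 + x.1.herm τ X.1) - (X.2.herm τ x.2 + x.2.herm τ X.2)) := by
  obtain ⟨A', hA, hA'⟩ := hasFDerivAt_fst_herm (τ := τ) x
  obtain ⟨B', hB, hB'⟩ := hasFDerivAt_snd_herm (τ := τ) x
  have h : HasFDerivAt (ham τ) ((1 / 2 : ℝ) • (A' - B')) x := (hA.sub hB).const_smul (1 / 2 : ℝ)
  rw [h.fderiv, ← hA', ← hB']
  rfl

theorem differentiable_ham : Differentiable ℝ (ham τ : Pt n p m q L → Ev L) := fun x => by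
  obtain ⟨A', hA, -⟩ := hasFDerivAt_fst_herm (τ := τ) x
  obtain ⟨B', hB, -⟩ := hasFDerivAt_snd_herm (τ := τ) x
  exact ((hA.sub hB).const_smul (1 / 2 : ℝ)).differentiableAt

theorem contDiffAt_weight (hτ : τ = Complex.I ∨ τ = -Complex.I) {x : Pt n p m q L}
    (hx : x ∈ X₀ n p m q L) : ContDiffAt ℝ (⊤ : ℕ∞) (weight τ) x :=
  ((contDiffAt_pow (isPos_fst hτ hx).2 _).comp x contDiff_fst_herm.contDiffAt).mul
    ((contDiffAt_pow (isPos_snd hτ hx).2 _).comp x contDiff_snd_herm.contDiffAt)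

theorem contDiffAt_lam (hτ : τ = Complex.I ∨ τ = -Complex.I) {x : Pt n p m q L}
    (hx : x ∈ X₀ n p m q L) : ContDiffAt ℝ (⊤ : ℕ∞) (lam τ) x := by
  have h1 : ContDiffAt ℝ (⊤ : ℕ∞) (fun x : Pt n p m q L => Ring.inverse (x.1.herm τ x.1)) x :=
    ContDiffAt.comp (g := Ring.inverse) x (contDiffAt_inverse (isPos_fst hτ hx).isUnit)
      contDiff_fst_herm.contDiffAt
  have h2 : ContDiffAt ℝ (⊤ : ℕ∞) (fun x : Pt n p m q L =>
      x.2.herm τ x.2 * Ring.inverse (x.1.herm τ x.1)) x :=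
    contDiff_snd_herm.contDiffAt.mul h1
  exact ContDiffAt.comp (g := fun A => Grassmann.pow A (1 / 4)) x
    (contDiffAt_pow ((isPos_snd hτ hx).mul (isPos_fst hτ hx).inverse).2 (1 / 4)) h2

theorem contDiffAt_smul {E ι : Type} [NormedAddCommGroup E] [NormedSpace ℝ E] [Fintype ι]
    {f : E → Ev L} {g : E → SVec ι p L} {x : E} (hf : ContDiffAt ℝ (⊤ : ℕ∞) f x)
    (hg : ContDiffAt ℝ (⊤ : ℕ∞) g x) : ContDiffAt ℝ (⊤ : ℕ∞) (fun x => f x • g x) x :=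
  (smulL ι p L).isBoundedBilinearMap.contDiff.contDiffAt.comp x (hf.prodMk hg)

theorem contDiffAt_s (hτ : τ = Complex.I ∨ τ = -Complex.I) {x : Pt n p m q L}
    (hx : x ∈ X₀ n p m q L) : ContDiffAt ℝ (⊤ : ℕ∞) (WeightedProj.s τ) x :=
  (contDiffAt_smul (contDiffAt_lam hτ hx) contDiffAt_fst).prodMk
    (contDiffAt_smul ((contDiffAt_inverse (isPos_lam hτ hx).isUnit).comp x (contDiffAt_lam hτ hx))
      contDiffAt_snd)

theorem hasFDerivAt_inverse {E : Type} [NormedAddCommGroup E] [NormedSpace ℝ E] {f : E → Ev L}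
    {f' : E →L[ℝ] Ev L} {x : E} (hf : HasFDerivAt f f' x) (hu : IsUnit (f x)) :
    ∃ g' : E →L[ℝ] Ev L, HasFDerivAt (fun x => Ring.inverse (f x)) g' x ∧
      ∀ X, g' X = -(Ring.inverse (f x) ^ 2 * f' X) := by
  obtain ⟨u, hu⟩ := hu
  have h := hasFDerivAt_ringInverse (𝕜 := ℝ) u
  rw [hu] at h
  refine ⟨_, h.comp x hf, fun X => ?_⟩
  rw [← hu, Ring.inverse_unit]
  simp
  ring

/-- The pullback of `ω₀` by `s` is the explicit form. -/
theorem omega_fderiv_s (hτ : τ = Complex.I ∨ τ = -Complex.I) {x : Pt n p m q L}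
    (hx : x ∈ X₀ n p m q L) (X Y : Pt n p m q L) :
    ω₀ τ (fderiv ℝ (WeightedProj.s τ) x X) (fderiv ℝ (WeightedProj.s τ) x Y) =
      explicitForm τ x X Y := by
  obtain ⟨A', hA, hA'⟩ := hasFDerivAt_fst_herm (τ := τ) x
  obtain ⟨B', hB, hB'⟩ := hasFDerivAt_snd_herm (τ := τ) x
  obtain ⟨l', hl⟩ := (contDiffAt_lam hτ hx).differentiableAt (by simp)
  obtain ⟨k', hk, hk'⟩ := hasFDerivAt_inverse hl (isPos_lam hτ hx).isUnit
  have h1 := (smulL (Fin n) p L).hasFDerivAt_of_bilinear hl (hasFDerivAt_fst (𝕜 := ℝ) (p := x))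
  have h2 := (smulL (Fin m) q L).hasFDerivAt_of_bilinear hk (hasFDerivAt_snd (𝕜 := ℝ) (p := x))
  have hs : ∀ X, fderiv ℝ (WeightedProj.s τ) x X = (lam τ x • X.1 + l' X • x.1,
      Ring.inverse (lam τ x) • X.2 + (-(Ring.inverse (lam τ x) ^ 2 * l' X)) • x.2) := fun X => by
    have h : HasFDerivAt (WeightedProj.s τ) _ x := h1.prodMk h2
    rw [h.fderiv, ← hk']
    rfl
  -- Differentiating `λ⁴ A = B`, which holds on the open set `X₀`, determines the derivative of `λ`
  -- without differentiating the binomial series.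
  have key : ∀ Z : Pt n p m q L, 4 * lam τ x ^ 3 * l' Z * x.1.herm τ x.1 +
      lam τ x ^ 4 * (Z.1.herm τ x.1 + x.1.herm τ Z.1) =
        Z.2.herm τ x.2 + x.2.herm τ Z.2 := fun Z => by
    have e1 := (hl.pow 4).mul hA
    have e2 : (fun x => lam τ x ^ 4 * x.1.herm τ x.1) =ᶠ[nhds x] fun x => x.2.herm τ x.2 :=
      Filter.eventually_of_mem (isOpen_X₀.mem_nhds hx) fun y hy => lam_pow_four hτ hy
    have e3 := congrArg (fun T : Pt n p m q L →L[ℝ] Ev L => T Z)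
      (e1.unique (hB.congr_of_eventuallyEq e2))
    rw [← hB', ← e3, ← hA']
    simp
    ring
  rw [hs, hs, omega_scaled hτ hx X Y (key X) (key Y)]

end WeightedProj

end

/-! ### Smooth dependence of a pulled-back 2-form on the linear map. -/

section

open ContinuousAlternatingMap in
/-- A constant alternating 2-form is pulled back smoothly by linear maps. -/
theorem ContinuousAlternatingMap.contDiffAt_compContinuousLinearMap_two {E F G H : Type*}
    [NormedAddCommGroup E] [NormedSpace ℝ E] [NormedAddCommGroup F] [NormedSpace ℝ F]
    [NormedAddCommGroup G] [NormedSpace ℝ G] [NormedAddCommGroup H] [NormedSpace ℝ H]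
    (B : F [⋀^Fin 2]→L[ℝ] G) {f : H → E →L[ℝ] F} {x : H} {r : WithTop ℕ∞}
    (hf : ContDiffAt ℝ r f x) :
    ContDiffAt ℝ r (fun y => B.compContinuousLinearMap (f y)) x := by
  let b : F →L[ℝ] F →L[ℝ] G :=
    (ofSubsingletonLIE (𝕜 := ℝ) (E := F) (F := G)
      (0 : Fin 1)).symm.toContinuousLinearEquiv.toContinuousLinearMap.comp B.curryLeft
  let e : (E →L[ℝ] G) →L[ℝ] (E [⋀^Fin 1]→L[ℝ] G) :=
    (ofSubsingletonLIE (𝕜 := ℝ) (0 : Fin 1)).toContinuousLinearEquiv.toContinuousLinearMap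
  have hb : ∀ X Y, b X Y = B ![X, Y] := fun X Y => by
    change B (Matrix.vecCons X fun _ : Fin 1 => Y) = _
    congr 1
    ext i
    fin_cases i <;> rfl
  -- The pullback is expressed through compositions of continuous linear maps, whose smoothness is
  -- known. Alternatizing a bilinear map that is already antisymmetric doubles it, hence the factor
  -- `1 / 2`.
  have h : ∀ y, B.compContinuousLinearMap (f y) = (1 / 2 : ℝ) • alternatizeUncurryFinCLM ℝ E G
      (e.comp (((ContinuousLinearMap.compL ℝ E F G).flip (f y)).comp (b.comp (f y)))) := by
    intro y
    ext v
    have hv : v = ![v 0, v 1] := by ext i; fin_cases i <;> rfl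
    have hs : B ![f y (v 1), f y (v 0)] = -B ![f y (v 0), f y (v 1)] := by
      have := B.toAlternatingMap.map_swap ![f y (v 0), f y (v 1)] (zero_ne_one (α := Fin 2))
      rw [← show (![f y (v 0), f y (v 1)] ∘ Equiv.swap (0 : Fin 2) 1) = ![f y (v 1), f y (v 0)] by
        ext i; fin_cases i <;> rfl]
      exact this
    have h1 : ∀ X Z, e.comp (((ContinuousLinearMap.compL ℝ E F G).flip (f y)).comp (b.comp (f y)))
        X Z = B ![f y X, f y (Z 0)] := fun X Z => hb _ _
    rw [ContinuousAlternatingMap.smul_apply, alternatizeUncurryFinCLM_apply,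
      alternatizeUncurryFin_apply, Fin.sum_univ_two, h1, h1]
    change B (f y ∘ v) = (1 / 2 : ℝ) • ((-1) ^ 0 • B ![f y (v 0), f y (v 1)] +
      (-1) ^ 1 • B ![f y (v 1), f y (v 0)])
    rw [hs, show f y ∘ v = ![f y (v 0), f y (v 1)] by ext i; fin_cases i <;> rfl]
    module
  simp only [h]
  have ha : ContDiff ℝ r (alternatizeUncurryFinCLM (n := 1) ℝ E G) :=
    ContinuousLinearMap.contDiff (𝕜 := ℝ) (E := E →L[ℝ] E [⋀^Fin 1]→L[ℝ] G)
      (F := E [⋀^Fin 2]→L[ℝ] G) (alternatizeUncurryFinCLM ℝ E G)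
  refine ContDiffAt.const_smul (1 / 2 : ℝ) (ContDiffAt.comp x ha.contDiffAt ?_)
  refine contDiffAt_const.clm_comp (ContDiffAt.clm_comp ?_ (contDiffAt_const.clm_comp hf))
  have hc : ContDiff ℝ r (ContinuousLinearMap.compL ℝ E F G).flip :=
    ContinuousLinearMap.contDiff (𝕜 := ℝ) (E := E →L[ℝ] F)
      (F := (F →L[ℝ] G) →L[ℝ] E →L[ℝ] G) (ContinuousLinearMap.compL ℝ E F G).flip
  exact ContDiffAt.comp x hc.contDiffAt hf
end

namespace Grassmann

/-- Even elements as elements of the Grassmann algebra. -/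
noncomputable def evCoe (L : ℕ) : Ev L →L[ℝ] Grassmann L :=
  LinearMap.toContinuousLinearMap
    { toFun := fun x => (x : Grassmann L), map_add' := fun _ _ => rfl,
      map_smul' := fun _ _ => rfl }

end Grassmann

/-! ### Slices, charts and their differentials. -/

section

attribute [local irreducible] Grassmann.instNormedCommRingEv

namespace WeightedProj

open Grassmann SVec

variable {n p m q L L' : ℕ} {τ : ℂ}

/-- Membership only provides some representative with the required properties; these do not depend
on the representative, because units have nonzero body. -/
theorem mem_source_iff {a : Fin n} {x : Pt n p m q L} :
    proj x ∈ source a ↔ x ∈ X₀ n p m q L ∧ body (x.1.1 a) ≠ 0 := by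
  refine ⟨?_, fun h => ⟨x, h, rfl⟩⟩
  rintro ⟨y, ⟨hy, hya⟩, hyx⟩
  obtain ⟨g, rfl⟩ := Quotient.exact hyx
  refine ⟨act_mem_X₀ g.mul_inv hy, ?_⟩
  change body ((g : Ev L) * y.1.1 a) ≠ 0
  rw [body_mul]
  exact mul_ne_zero ((isUnit_iff _).1 g.isUnit) hya

theorem slice_mem_X₀ {a : Fin n} {y : Model n p m q L a} (hy : y ∈ target a) :
    slice a y ∈ X₀ n p m q L :=
  ⟨⟨a, by simp [slice, body_one]⟩, hy⟩

theorem slice_apply_self (a : Fin n) (y : Model n p m q L a) : (slice a y).1.1 a = 1 := by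
  simp [slice]

theorem proj_slice_mem_source {a : Fin n} {y : Model n p m q L a} (hy : y ∈ target a) :
    proj (slice a y) ∈ source a :=
  mem_source_iff.2 ⟨slice_mem_X₀ hy, by simp [slice_apply_self, body_one]⟩

/-- The differential of the map `slice a`. -/
noncomputable def sliceL (a : Fin n) : Model n p m q L a →L[ℝ] Pt n p m q L :=
  LinearMap.toContinuousLinearMap
    { toFun := fun Y => ((fun b => if h : b = a then 0 else Y.1.1 ⟨b, h⟩, Y.1.2), Y.2)
      map_add' := fun X Y => Prod.ext (Prod.ext (funext fun b => by
        by_cases h : b = a <;> simp [h]) rfl) rfl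
      map_smul' := fun c Y => Prod.ext (Prod.ext (funext fun b => by
        by_cases h : b = a <;> simp [h]) rfl) rfl }

theorem sliceL_apply (a : Fin n) (Y : Model n p m q L a) :
    sliceL a Y = ((fun b => if h : b = a then 0 else Y.1.1 ⟨b, h⟩, Y.1.2), Y.2) := rfl

theorem sliceL_smul (a : Fin n) (c : Ev L) (Y : Model n p m q L a) :
    sliceL a (c • Y) = c • sliceL a Y := by
  refine Prod.ext (Prod.ext (funext fun b => ?_) rfl) rfl
  by_cases h : b = a <;> simp [h, sliceL_apply]

/-- The inverse of `sliceL a`, which leaves out the coordinate `vᵃ`. -/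
noncomputable def restrictL (a : Fin n) : Pt n p m q L →L[ℝ] Model n p m q L a :=
  LinearMap.toContinuousLinearMap
    { toFun := fun x => ((fun b : {b : Fin n // b ≠ a} => x.1.1 b.1, x.1.2), x.2)
      map_add' := fun _ _ => rfl
      map_smul' := fun _ _ => rfl }

theorem restrictL_apply (a : Fin n) (x : Pt n p m q L) :
    restrictL a x = ((fun b : {b : Fin n // b ≠ a} => x.1.1 b.1, x.1.2), x.2) := rfl

theorem restrictL_sliceL (a : Fin n) (Y : Model n p m q L a) : restrictL a (sliceL a Y) = Y :=
  Prod.ext (Prod.ext (funext fun b => by simp [restrictL_apply, sliceL_apply, b.2]) rfl) rfl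

theorem slice_restrictL {a : Fin n} {x : Pt n p m q L} (hx : x.1.1 a = 1) :
    slice a (restrictL a x) = x := by
  refine Prod.ext (Prod.ext (funext fun b => ?_) rfl) rfl
  by_cases h : b = a
  · subst h; simp [slice, hx]
  · simp [slice, h, restrictL_apply]

theorem slice_eq (a : Fin n) : (slice a : Model n p m q L a → Pt n p m q L) =
    fun y => sliceL a y + slice a 0 := funext fun y =>
  Prod.ext (Prod.ext (funext fun b => by
    by_cases h : b = a <;> simp [slice, sliceL_apply, h]) (by simp [slice, sliceL_apply]))
    (by simp [slice, sliceL_apply])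

theorem hasFDerivAt_slice (a : Fin n) (y : Model n p m q L a) :
    HasFDerivAt (slice a) (sliceL a) y := by
  rw [slice_eq]
  exact (sliceL a).hasFDerivAt.add_const _

theorem contDiff_slice (a : Fin n) :
    ContDiff ℝ (⊤ : ℕ∞) (slice a : Model n p m q L a → Pt n p m q L) := by
  rw [slice_eq]
  exact (sliceL a).contDiff.add contDiff_const

/-- The representative `(v / vᵃ, vᵃ w)` of `[v ‖ w]`. -/
noncomputable def normalize (a : Fin n) (x : Pt n p m q L) : Pt n p m q L :=
  (Ring.inverse (x.1.1 a) • x.1, x.1.1 a • x.2)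

theorem chart_proj (a : Fin n) (x : Pt n p m q L) :
    chart a (proj x) = restrictL a (normalize a x) := rfl

theorem normalize_apply_self {a : Fin n} {x : Pt n p m q L} (hx : IsUnit (x.1.1 a)) :
    (normalize a x).1.1 a = 1 := Ring.inverse_mul_cancel _ hx

/-- The derivative is arranged as the action of `(vᵃ)⁻¹` on `X` plus a vertical vector, the shape to
which `explicitForm_normalize` applies. -/
theorem hasFDerivAt_normalize {a : Fin n} {x : Pt n p m q L} (hx : IsUnit (x.1.1 a)) :
    ∃ N' : Pt n p m q L →L[ℝ] Pt n p m q L, HasFDerivAt (normalize a) N' x ∧ ∀ X, N' X =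
      (Ring.inverse (x.1.1 a) • (X.1 + (-(Ring.inverse (x.1.1 a) * X.1.1 a)) • x.1),
        x.1.1 a • (X.2 + (-(-(Ring.inverse (x.1.1 a) * X.1.1 a))) • x.2)) := by
  let c : Pt n p m q L →L[ℝ] Ev L := (ContinuousLinearMap.proj (R := ℝ) (φ := fun _ => Ev L) a).comp
    ((ContinuousLinearMap.fst ℝ _ _).comp (ContinuousLinearMap.fst ℝ _ _))
  have hc : HasFDerivAt (fun x : Pt n p m q L => x.1.1 a) c x := c.hasFDerivAt
  obtain ⟨k', hk, hk'⟩ := hasFDerivAt_inverse hc hx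
  have h1 := (smulL (Fin n) p L).hasFDerivAt_of_bilinear hk (hasFDerivAt_fst (𝕜 := ℝ) (p := x))
  have h2 := (smulL (Fin m) q L).hasFDerivAt_of_bilinear hc (hasFDerivAt_snd (𝕜 := ℝ) (p := x))
  refine ⟨_, h1.prodMk h2, fun X => ?_⟩
  have e : x.1.1 a * Ring.inverse (x.1.1 a) = 1 := Ring.mul_inverse_cancel _ hx
  have e1 : k' X = Ring.inverse (x.1.1 a) * (-(Ring.inverse (x.1.1 a) * X.1.1 a)) := by
    rw [hk']
    change -(Ring.inverse (x.1.1 a) ^ 2 * X.1.1 a) = _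
    ring
  have e2 : c X = x.1.1 a * -(-(Ring.inverse (x.1.1 a) * X.1.1 a)) := by
    change X.1.1 a = _
    linear_combination (-X.1.1 a) * e
  rw [smul_add, smul_add, smul_smul, smul_smul, ← e1, ← e2]
  rfl

/-- Near `x` the composite of the chart with `slice a` is `normalize a`, so the derivative is read
off from that of `normalize a`. -/
theorem hasFDerivAt_chart_proj {a : Fin n} {x : Pt n p m q L} (hx : IsUnit (x.1.1 a)) :
    ∃ C' : Pt n p m q L →L[ℝ] Model n p m q L a,
      HasFDerivAt (fun x => chart a (proj x)) C' x ∧ ∀ X, sliceL a (C' X) =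
      (Ring.inverse (x.1.1 a) • (X.1 + (-(Ring.inverse (x.1.1 a) * X.1.1 a)) • x.1),
        x.1.1 a • (X.2 + (-(-(Ring.inverse (x.1.1 a) * X.1.1 a))) • x.2)) := by
  obtain ⟨N', hN, hN'⟩ := hasFDerivAt_normalize hx
  have hC : HasFDerivAt (fun x => chart a (proj x)) ((restrictL a).comp N') x :=
    (restrictL a).hasFDerivAt.comp x hN
  refine ⟨_, hC, fun X => ?_⟩
  have h2 : HasFDerivAt (fun x => slice a (chart a (proj x))) _ x :=
    (hasFDerivAt_slice a _).comp x hC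
  have hb : ∀ᶠ y : Pt n p m q L in nhds x, IsUnit (y.1.1 a) :=
    (continuous_apply a |>.comp (continuous_fst.comp continuous_fst)).continuousAt.eventually
      (Units.isOpen.mem_nhds hx)
  have h3 : normalize a =ᶠ[nhds x] fun x => slice a (chart a (proj x)) := hb.mono fun y hy =>
    (slice_restrictL (normalize_apply_self hy)).symm
  rw [← hN']
  exact (DFunLike.congr_fun (hN.unique (h2.congr_of_eventuallyEq h3)) X).symm

/-- This is the statement that the explicit form is basic: vertical summands are dropped in both
arguments, and the action of `k` leaves the rest unchanged. -/
theorem explicitForm_normalize (hτ : τ = Complex.I ∨ τ = -Complex.I) {x : Pt n p m q L}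
    (hx : x ∈ X₀ n p m q L) {k u : Ev L} (hku : k * u = 1) (X Y : Pt n p m q L) (c d : Ev L) :
    explicitForm τ (k • x.1, u • x.2) (k • (X.1 + c • x.1), u • (X.2 + (-c) • x.2))
      (k • (Y.1 + d • x.1), u • (Y.2 + (-d) • x.2)) = explicitForm τ x X Y := by
  have h := bracket_act (τ := τ) hku x (X + (c • x.1, (-c) • x.2)) (Y + (d • x.1, (-d) • x.2))
  simp only [Prod.fst_add, Prod.snd_add] at h
  rw [explicitForm_eq, explicitForm_eq, weight_act hτ hku hx, h, bracket_add_left,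
    bracket_vertical, add_zero, bracket_swap, bracket_add_left, bracket_vertical, add_zero,
    bracket_swap, neg_neg]

/-! ### The form -/

theorem omega_swap (X Y : Pt n p m q L) : ω₀ τ X Y = -ω₀ τ Y X := by
  rw [ω₀, ω₀, ← smul_neg]
  simp only [dd]
  congr 1
  ring

theorem omega_add_left (X X' Y : Pt n p m q L) : ω₀ τ (X + X') Y = ω₀ τ X Y + ω₀ τ X' Y := by
  simp only [ω₀, dd, Prod.fst_add, Prod.snd_add, herm_add_left, herm_add_right, ← smul_add]
  congr 1
  ring

theorem omega_smul_left (r : ℝ) (X Y : Pt n p m q L) : ω₀ τ (r • X) Y = r • ω₀ τ X Y := by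
  simp only [ω₀, dd, Prod.smul_fst, Prod.smul_snd, herm_real_smul_left, herm_real_smul_right,
    ← smul_sub, ← smul_add]
  rw [smul_comm]

variable (τ) in
/-- `ω₀` as a continuous bilinear map. -/
noncomputable def omegaL (n p m q L : ℕ) :
    Pt n p m q L →L[ℝ] Pt n p m q L →L[ℝ] Ev L :=
  (LinearMap.mk₂ ℝ (ω₀ τ) omega_add_left omega_smul_left
    (fun X Y Y' => by
      rw [omega_swap, omega_add_left, neg_add, ← omega_swap, ← omega_swap])
    (fun r X Y => by
      rw [omega_swap, omega_smul_left, ← smul_neg, ← omega_swap])).toContinuousBilinearMap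

theorem omegaL_apply (X Y : Pt n p m q L) : omegaL τ n p m q L X Y = ω₀ τ X Y := rfl

variable (τ) in
/-- `ω₀` as an alternating form with values in the Grassmann algebra. -/
noncomputable def omegaForm (n p m q L : ℕ) : Pt n p m q L [⋀^Fin 2]→L[ℝ] Grassmann L where
  toFun v := evCoe L (omegaL τ n p m q L (v 0) (v 1))
  map_update_add' v i X Y := by fin_cases i <;> simp
  map_update_smul' v i r X := by fin_cases i <;> simp
  map_eq_zero_of_eq' v i j h hij := by
    have h0 : ∀ X : Pt n p m q L, omegaL τ n p m q L X X = 0 := fun X => by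
      simp [omegaL_apply, ω₀, dd]
    fin_cases i <;> fin_cases j <;> simp_all
  cont := by
    have h0 : Continuous fun v : Fin 2 → Pt n p m q L => v 0 := continuous_apply 0
    have h1 : Continuous fun v : Fin 2 → Pt n p m q L => v 1 := continuous_apply 1
    exact (evCoe L).continuous.comp (((omegaL τ n p m q L).continuous.comp h0).clm_apply h1)

end WeightedProj

end

section

attribute [local irreducible] Grassmann.instNormedCommRingEv

namespace WeightedProj

open Grassmann SVec

variable {n p m q L L' : ℕ} {τ : ℂ}

/-! ### Superdifferentiable functions -/

/-- `f` is differentiable at `x`, and its derivative is linear over the real even elements. -/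
def SuperDifferentiableAt (f : Pt n p m q L → Ev L) (x : Pt n p m q L) : Prop :=
  ∃ f' : Pt n p m q L →L[ℝ] Ev L, HasFDerivAt f f' x ∧
    ∀ c : Ev L, conjHom L c = c → ∀ Z, f' (c • Z) = c * f' Z

namespace SuperDifferentiableAt

variable {f g : Pt n p m q L → Ev L} {x : Pt n p m q L}

theorem const (c : Ev L) : SuperDifferentiableAt (fun _ => c) x :=
  ⟨0, hasFDerivAt_const c x, fun _ _ _ => (mul_zero _).symm⟩

theorem add (hf : SuperDifferentiableAt f x) (hg : SuperDifferentiableAt g x) :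
    SuperDifferentiableAt (fun x => f x + g x) x := by
  obtain ⟨f', hf, hf'⟩ := hf
  obtain ⟨g', hg, hg'⟩ := hg
  refine ⟨f' + g', hf.add hg, fun c hc Z => ?_⟩
  rw [_root_.add_apply, _root_.add_apply, hf' c hc, hg' c hc, mul_add]

theorem sub (hf : SuperDifferentiableAt f x) (hg : SuperDifferentiableAt g x) :
    SuperDifferentiableAt (fun x => f x - g x) x := by
  obtain ⟨f', hf, hf'⟩ := hf
  obtain ⟨g', hg, hg'⟩ := hg
  refine ⟨f' - g', hf.sub hg, fun c hc Z => ?_⟩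
  rw [_root_.sub_apply, _root_.sub_apply, hf' c hc, hg' c hc, mul_sub]

theorem mul (hf : SuperDifferentiableAt f x) (hg : SuperDifferentiableAt g x) :
    SuperDifferentiableAt (fun x => f x * g x) x := by
  obtain ⟨f', hf, hf'⟩ := hf
  obtain ⟨g', hg, hg'⟩ := hg
  refine ⟨_, hf.mul hg, fun c hc Z => ?_⟩
  simp only [_root_.add_apply, _root_.smul_apply, hf' c hc, hg' c hc,
    smul_eq_mul]
  ring

theorem npow (hf : SuperDifferentiableAt f x) (k : ℕ) :
    SuperDifferentiableAt (fun x => f x ^ k) x := by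
  induction k with
  | zero => simpa using const 1
  | succ k ih => simpa only [pow_succ] using ih.mul hf

theorem fst_herm : SuperDifferentiableAt (fun x : Pt n p m q L => x.1.herm τ x.1) x := by
  obtain ⟨A', hA, hA'⟩ := hasFDerivAt_fst_herm (τ := τ) x
  refine ⟨A', hA, fun c hc Z => ?_⟩
  rw [hA', hA', Prod.smul_fst, herm_smul_left, herm_smul_right, hc, mul_add]

theorem snd_herm : SuperDifferentiableAt (fun x : Pt n p m q L => x.2.herm τ x.2) x := by
  obtain ⟨B', hB, hB'⟩ := hasFDerivAt_snd_herm (τ := τ) x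
  refine ⟨B', hB, fun c hc Z => ?_⟩
  rw [hB', hB', Prod.smul_snd, herm_smul_left, herm_smul_right, hc, mul_add]

theorem of_linear (l : Pt n p m q L →L[ℝ] Ev L)
    (h : ∀ c : Ev L, conjHom L c = c → ∀ Z, l (c • Z) = c * l Z) : SuperDifferentiableAt l x :=
  ⟨l, l.hasFDerivAt, h⟩

theorem fst_herm_left (v : SVec (Fin n) p L) :
    SuperDifferentiableAt (fun x : Pt n p m q L => x.1.herm τ v) x :=
  of_linear (((hermL τ (Fin n) p L).flip v).comp (ContinuousLinearMap.fst ℝ _ _)) fun c _ Z =>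
    herm_smul_left c Z.1 v

theorem fst_herm_right (v : SVec (Fin n) p L) :
    SuperDifferentiableAt (fun x : Pt n p m q L => v.herm τ x.1) x :=
  of_linear ((hermL τ (Fin n) p L v).comp (ContinuousLinearMap.fst ℝ _ _)) fun c hc Z =>
    (herm_smul_right c v Z.1).trans (by rw [hc]; rfl)

theorem snd_herm_left (w : SVec (Fin m) q L) :
    SuperDifferentiableAt (fun x : Pt n p m q L => x.2.herm τ w) x :=
  of_linear (((hermL τ (Fin m) q L).flip w).comp (ContinuousLinearMap.snd ℝ _ _)) fun c _ Z =>
    herm_smul_left c Z.2 w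

theorem snd_herm_right (w : SVec (Fin m) q L) :
    SuperDifferentiableAt (fun x : Pt n p m q L => w.herm τ x.2) x :=
  of_linear ((hermL τ (Fin m) q L w).comp (ContinuousLinearMap.snd ℝ _ _)) fun c hc Z =>
    (herm_smul_right c w Z.2).trans (by rw [hc]; rfl)

theorem bracket (X Y : Pt n p m q L) : SuperDifferentiableAt (fun x => bracket τ x X Y) x := by
  have hA := fst_herm (τ := τ) (x := x)
  have hB := snd_herm (τ := τ) (x := x)
  have h1 := fun v => fst_herm_left (τ := τ) (x := x) v
  have h2 := fun v => fst_herm_right (τ := τ) (x := x) v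
  have h3 := fun v => snd_herm_left (τ := τ) (x := x) v
  have h4 := fun v => snd_herm_right (τ := τ) (x := x) v
  exact (((hA.mul (hB.npow 2)).mul (const _)).add (((hA.npow 2).mul hB).mul (const _))).sub
    ((const _).mul ((((
      (hB.npow 2).mul (((h2 X.1).mul (h1 Y.1)).sub ((h2 Y.1).mul (h1 X.1)))).add
      ((hA.npow 2).mul (((h4 X.2).mul (h3 Y.2)).sub ((h4 Y.2).mul (h3 X.2))))).sub
      ((hA.mul hB).mul (((h4 X.2).mul (h1 Y.1)).sub ((h4 Y.2).mul (h1 X.1))))).sub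
      ((hA.mul hB).mul (((h2 X.1).mul (h3 Y.2)).sub ((h2 Y.1).mul (h3 X.2))))))

/-- With `Q = (A B)³`, differentiating `W² Q = 1` gives `2 W Q dW = -W² dQ`. The coefficient `2 W Q`
is a unit, so `dW` inherits linearity over the real even elements from `dQ`. -/
theorem weight (hτ : τ = Complex.I ∨ τ = -Complex.I) (hx : x ∈ X₀ n p m q L) :
    SuperDifferentiableAt (weight τ) x := by
  obtain ⟨W', hW⟩ := (contDiffAt_weight hτ hx).differentiableAt (by simp)
  obtain ⟨Q', hQ, hQ'⟩ := (fst_herm (τ := τ) (x := x)).mul (snd_herm (τ := τ)) |>.npow 3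
  refine ⟨W', hW, fun c hc Z => ?_⟩
  have e1 := (hW.pow 2).mul hQ
  have e2 : (fun x : Pt n p m q L => WeightedProj.weight τ x ^ 2 *
      (x.1.herm τ x.1 * x.2.herm τ x.2) ^ 3) =ᶠ[nhds x] fun _ => 1 :=
    Filter.eventually_of_mem (isOpen_X₀.mem_nhds hx) fun y hy => weight_sq hτ hy
  have e3 : ∀ Z, 2 * (WeightedProj.weight τ x * (x.1.herm τ x.1 * x.2.herm τ x.2) ^ 3) * W' Z =
      -(WeightedProj.weight τ x ^ 2 * Q' Z) := fun Z => by
    have := DFunLike.congr_fun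
      (e1.unique ((hasFDerivAt_const (1 : Ev L) x).congr_of_eventuallyEq e2)) Z
    simp at this
    linear_combination this
  have hu : IsUnit (2 * (WeightedProj.weight τ x * (x.1.herm τ x.1 * x.2.herm τ x.2) ^ 3)) :=
    (IsUnit.of_mul_eq_one _ two_mul_half).mul ((isPos_weight hτ hx).mul
      (((isPos_fst hτ hx).mul (isPos_snd hτ hx)).npow 3)).isUnit
  refine hu.mul_left_cancel ?_
  rw [e3, hQ' c hc]
  linear_combination (-c) * e3 Z

end SuperDifferentiableAt

/-! ### The form on the quotient -/

theorem alternating_ext_two {E F : Type*} [NormedAddCommGroup E] [NormedSpace ℝ E]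
    [NormedAddCommGroup F] [NormedSpace ℝ F] {α β : E [⋀^Fin 2]→L[ℝ] F}
    (h : ∀ X Y, α ![X, Y] = β ![X, Y]) : α = β := by
  ext v
  have hv : v = ![v 0, v 1] := by ext i; fin_cases i <;> rfl
  rw [hv]
  exact h _ _

theorem comp_cons_two {E F : Type*} (f : E → F) (X Y : E) : f ∘ ![X, Y] = ![f X, f Y] := by
  ext i; fin_cases i <;> rfl

variable (τ) in
/-- The reduced 2-form on `P_{1,-1}(V ⊕ W)`. -/
noncomputable def form (n p m q : ℕ) : FormData n p m q := fun L a y =>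
  (omegaForm τ n p m q L).compContinuousLinearMap
    (fderiv ℝ (fun y => WeightedProj.s τ (slice a y)) y)

theorem contDiffAt_s_slice (hτ : τ = Complex.I ∨ τ = -Complex.I) {a : Fin n}
    {y : Model n p m q L a} (hy : y ∈ target a) :
    ContDiffAt ℝ (⊤ : ℕ∞) (fun y => WeightedProj.s τ (slice a y)) y :=
  ContDiffAt.comp y (contDiffAt_s hτ (slice_mem_X₀ hy)) (contDiff_slice a).contDiffAt

theorem form_apply' (a : Fin n) (y X Y : Model n p m q L a) :
    form τ n p m q L a y ![X, Y] =
      (ω₀ τ (fderiv ℝ (fun y => WeightedProj.s τ (slice a y)) y X)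
        (fderiv ℝ (fun y => WeightedProj.s τ (slice a y)) y Y) : Ev L) := rfl

theorem fderiv_s_slice (hτ : τ = Complex.I ∨ τ = -Complex.I) {a : Fin n}
    {y : Model n p m q L a} (hy : y ∈ target a) :
    fderiv ℝ (fun y => WeightedProj.s τ (slice a y)) y =
      (fderiv ℝ (WeightedProj.s τ) (slice a y)).comp (sliceL a) :=
  (((contDiffAt_s hτ (slice_mem_X₀ hy)).differentiableAt (by simp)).hasFDerivAt.comp y
    (hasFDerivAt_slice a y)).fderiv

theorem form_apply (hτ : τ = Complex.I ∨ τ = -Complex.I) {a : Fin n}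
    {y : Model n p m q L a} (hy : y ∈ target a) (X Y : Model n p m q L a) :
    form τ n p m q L a y ![X, Y] =
      (explicitForm τ (slice a y) (sliceL a X) (sliceL a Y) : Ev L) := by
  rw [form_apply', fderiv_s_slice hτ hy, ← omega_fderiv_s hτ (slice_mem_X₀ hy)]
  rfl

theorem contDiffOn_form (hτ : τ = Complex.I ∨ τ = -Complex.I) (a : Fin n) :
    ContDiffOn ℝ (⊤ : ℕ∞) (form τ n p m q L a) (target a) := fun y hy =>
  ((omegaForm τ n p m q L).contDiffAt_compContinuousLinearMap_two
    ((contDiffAt_s_slice hτ hy).fderiv_right (m := (⊤ : ℕ∞)) (by simp))).contDiffWithinAt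

/-- The exterior derivative commutes with the pullback by `s ∘ slice a`, and `ω₀` has constant
coefficients. -/
theorem isClosedForm_form (hτ : τ = Complex.I ∨ τ = -Complex.I) :
    IsClosedForm (form τ n p m q) := fun L a y hy => by
  have h := extDeriv_pullback (ω := fun _ => omegaForm τ n p m q L)
    (differentiableAt_const _) (contDiffAt_s_slice hτ hy)
    (by rw [minSmoothness_of_isRCLikeNormedField]; exact WithTop.coe_le_coe.2 (le_top : (2 : ℕ∞) ≤ ⊤))
  refine h.trans ?_
  rw [extDeriv, fderiv_fun_const]
  ext v
  simp [ContinuousAlternatingMap.alternatizeUncurryFin_apply]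

/-- The left side is the explicit form evaluated after `normalize a`, which changes nothing because
that form is basic. -/
theorem pullback_proj (hτ : τ = Complex.I ∨ τ = -Complex.I) {a : Fin n} {x : Pt n p m q L}
    (hx : proj x ∈ source a) (X Y : Pt n p m q L) :
    pullback (form τ n p m q) proj a x ![X, Y] = (explicitForm τ x X Y : Ev L) := by
  obtain ⟨hx0, hxa⟩ := mem_source_iff.1 hx
  have hu := (isUnit_iff _).2 hxa
  obtain ⟨C', hC, hC'⟩ := hasFDerivAt_chart_proj hu
  have ht : chart a (proj x) ∈ target a := (chart_invOn a).2.1 hx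
  rw [pullback, ContinuousAlternatingMap.compContinuousLinearMap_apply, comp_cons_two,
    form_apply hτ ht, hC.fderiv, hC', hC', chart_proj, slice_restrictL (normalize_apply_self hu),
    normalize, explicitForm_normalize hτ hx0 (Ring.inverse_mul_cancel _ hu)]

/-- Both sides are the restriction to the slice `vᵇ = 1` of one and the same form on `X₀`. -/
theorem form_compatible (hτ : τ = Complex.I ∨ τ = -Complex.I) (a b : Fin n)
    {y : Model n p m q L b} (hy : y ∈ target b) (hya : proj (slice b y) ∈ source a) :
    pullback (form τ n p m q) (fun y' => proj (slice b y')) a y = form τ n p m q L b y := by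
  obtain ⟨C', hC, -⟩ := hasFDerivAt_chart_proj ((isUnit_iff _).2 (mem_source_iff.1 hya).2)
  have h : HasFDerivAt (fun y' => chart a (proj (slice b y'))) (C'.comp (sliceL b)) y :=
    hC.comp y (hasFDerivAt_slice b y)
  refine alternating_ext_two fun X Y => ?_
  rw [form_apply hτ hy, ← pullback_proj hτ hya, pullback, pullback, h.fderiv, hC.fderiv]
  simp only [ContinuousAlternatingMap.compContinuousLinearMap_apply, comp_cons_two]
  rfl

theorem explicitForm_of_tangent (hτ : τ = Complex.I ∨ τ = -Complex.I) {x X Y : Pt n p m q L}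
    (hx : x ∈ Γ₀ n p m q L τ) (hX : X ∈ tangentΓ₀ τ x) (hY : Y ∈ tangentΓ₀ τ x) :
    explicitForm τ x X Y = ω₀ τ X Y := by
  have half_inj : ∀ z w : Ev L, (1 / 2 : ℝ) • (z - w) = 0 → z = w := fun z w h => by
    rw [half_smul] at h
    exact sub_eq_zero.1 ((IsUnit.of_mul_eq_one _
      ((mul_comm _ _).trans two_mul_half)).mul_left_cancel (h.trans (mul_zero _).symm))
  have hAB : x.1.herm τ x.1 = x.2.herm τ x.2 := half_inj _ _ hx.2
  have hX' := half_inj _ _ ((fderiv_ham x X).symm.trans hX)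
  have hY' := half_inj _ _ ((fderiv_ham x Y).symm.trans hY)
  have hA := isPos_fst hτ hx.1
  have h1 : IsPos (1 : Ev L) := by simpa using hA.npow 0
  have hW : weight τ x * x.1.herm τ x.1 ^ 3 = 1 := by
    refine ((isPos_weight hτ hx.1).mul (hA.npow 3)).eq_of_sq_eq h1 ?_
    have := weight_sq hτ hx.1
    rw [← hAB] at this
    linear_combination this
  rw [explicitForm_eq, ω₀]
  congr 1
  simp only [bracket, dd, ← hAB]
  have key : X.1.herm τ x.1 - X.2.herm τ x.2 = x.2.herm τ X.2 - x.1.herm τ X.1 := by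
    linear_combination hX'
  have key' : Y.1.herm τ x.1 - Y.2.herm τ x.2 = x.2.herm τ Y.2 - x.1.herm τ Y.1 := by
    linear_combination hY'
  -- For `A = B` the quadratic terms form the wedge of `⟨dv, v⟩ - ⟨dw, w⟩` with its conjugate. On
  -- tangent vectors the conjugate is the negative of the first factor, so the wedge vanishes.
  linear_combination (X.1.herm τ Y.1 - Y.1.herm τ X.1 + (X.2.herm τ Y.2 - Y.2.herm τ X.2)) * hW
    - weight τ x * algebraMap ℝ (Ev L) (1 / 2) * x.1.herm τ x.1 ^ 2 *
      ((X.1.herm τ x.1 - X.2.herm τ x.2) * key' - (Y.1.herm τ x.1 - Y.2.herm τ x.2) * key)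

theorem isReductionOf_form (hτ : τ = Complex.I ∨ τ = -Complex.I) :
    IsReductionOf τ (form τ n p m q) := fun L x hx a hxa X hX Y hY => by
  rw [pullback_proj hτ hxa, explicitForm_of_tangent hτ hx hX hY]

/-- The differential of `s ∘ slice a` lifts every tangent vector of the chart to one of `Γ₀` (`hT`),
and projecting the lift returns the vector (`hid`). The values of `ω` are thus prescribed by `ω₀`.
-/
theorem reduction_unique (hτ : τ = Complex.I ∨ τ = -Complex.I) {ω : FormData n p m q}
    (hω : IsReductionOf τ ω) (L : ℕ) (a : Fin n) :
    Set.EqOn (ω L a) (form τ n p m q L a) (target a) := fun y hy => by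
  have hx0 := slice_mem_X₀ hy
  have hps := proj_s hτ hx0
  have hsrc : proj (WeightedProj.s τ (slice a y)) ∈ source a := by
    rw [hps]; exact proj_slice_mem_source hy
  have hS := (contDiffAt_s_slice hτ hy).differentiableAt (by simp) |>.hasFDerivAt
  have hev : ∀ᶠ y' : Model n p m q L a in nhds y, y' ∈ target a := (isOpen_target a).mem_nhds hy
  have hT : ∀ Z, fderiv ℝ (fun y => WeightedProj.s τ (slice a y)) y Z ∈
      tangentΓ₀ τ (WeightedProj.s τ (slice a y)) := fun Z => by
    have h1 : HasFDerivAt (fun y => ham τ (WeightedProj.s τ (slice a y))) _ y :=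
      (differentiable_ham (τ := τ) _).hasFDerivAt.comp y hS
    have h2 : (fun y => ham τ (WeightedProj.s τ (slice a y))) =ᶠ[nhds y] fun _ => 0 :=
      hev.mono fun y' hy' => ham_s hτ (slice_mem_X₀ hy')
    exact DFunLike.congr_fun
      (h1.unique ((hasFDerivAt_const (0 : Ev L) y).congr_of_eventuallyEq h2)) Z
  obtain ⟨C', hC, -⟩ := hasFDerivAt_chart_proj ((isUnit_iff _).2 (mem_source_iff.1 hsrc).2)
  have hid : ∀ Z, C' (fderiv ℝ (fun y => WeightedProj.s τ (slice a y)) y Z) = Z := fun Z => by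
    have h1 : HasFDerivAt (fun y => chart a (proj (WeightedProj.s τ (slice a y)))) _ y :=
      HasFDerivAt.comp (g := fun x => chart a (proj x)) y hC hS
    have h2 : (fun y => chart a (proj (WeightedProj.s τ (slice a y)))) =ᶠ[nhds y] fun y => y :=
      hev.mono fun y' hy' => by
        change chart a (proj _) = y'
        rw [proj_s hτ (slice_mem_X₀ hy')]
        exact (chart_invOn a).1.2 hy'
    exact DFunLike.congr_fun (h1.unique ((hasFDerivAt_id y).congr_of_eventuallyEq h2)) Z
  refine alternating_ext_two fun X Y => ?_
  have h := hω L _ ⟨s_mem_X₀ hτ hx0, ham_s hτ hx0⟩ a hsrc _ (hT X) _ (hT Y)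
  rw [pullback, ContinuousAlternatingMap.compContinuousLinearMap_apply, comp_cons_two, hC.fderiv,
    hid, hid, hps, (chart_invOn a).1.2 hy] at h
  exact h

theorem evCoe_mul (c x : Ev L) : evCoe L (c * x) = evCoe L c * evCoe L x := Ev.coe_mul c x

theorem form_linear (hτ : τ = Complex.I ∨ τ = -Complex.I) {a : Fin n} {y : Model n p m q L a}
    (hy : y ∈ target a) {c : Ev L} (hc : conjEv c = c) (X Y : Model n p m q L a) :
    form τ n p m q L a y ![c • X, Y] = c * form τ n p m q L a y ![X, Y] := by
  rw [form_apply hτ hy, form_apply hτ hy, sliceL_smul, explicitForm_eq, explicitForm_eq,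
    bracket_smul_left hc, ← Ev.coe_mul]
  congr 1
  rw [complex_smul_mul]
  congr 1
  ring

theorem form_deriv_linear (hτ : τ = Complex.I ∨ τ = -Complex.I) {a : Fin n}
    {y : Model n p m q L a} (hy : y ∈ target a) {c : Ev L} (hc : conjEv c = c)
    (X Y Z : Model n p m q L a) :
    fderiv ℝ (fun y' => form τ n p m q L a y' ![X, Y]) y (c • Z) =
      c * fderiv ℝ (fun y' => form τ n p m q L a y' ![X, Y]) y Z := by
  obtain ⟨f', hf, hf'⟩ := ((SuperDifferentiableAt.weight hτ (slice_mem_X₀ hy)).mul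
    (SuperDifferentiableAt.bracket (τ := τ) (sliceL a X) (sliceL a Y)))
  have h1 : HasFDerivAt (fun y' => evCoe L (explicitForm τ (slice a y') (sliceL a X) (sliceL a Y)))
      ((evCoe L).comp (((Complex.I / 2) • f').comp (sliceL a))) y := by
    simp only [explicitForm_eq]
    exact (evCoe L).hasFDerivAt.comp y ((hf.const_smul (Complex.I / 2)).comp y
      (hasFDerivAt_slice a y))
  have h2 : (fun y' => form τ n p m q L a y' ![X, Y]) =ᶠ[nhds y]
      fun y' => evCoe L (explicitForm τ (slice a y') (sliceL a X) (sliceL a Y)) :=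
    Filter.eventually_of_mem ((isOpen_target a).mem_nhds hy) fun y' hy' => form_apply hτ hy' X Y
  rw [(h1.congr_of_eventuallyEq h2).fderiv]
  change evCoe L ((Complex.I / 2) • f' (sliceL a (c • Z))) =
    evCoe L c * evCoe L ((Complex.I / 2) • f' (sliceL a Z))
  rw [sliceL_smul, hf' c hc, ← complex_smul_mul, evCoe_mul]

end WeightedProj

end

/-! ### Adjoining an odd generator. -/

namespace Grassmann

open Finset

variable {L : ℕ}

/-- The coefficients of an element after an additional generator has been adjoined. -/
noncomputable def extend (x : Grassmann L) : Grassmann (L + 1) := fun U =>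
  if Fin.last L ∈ U then 0 else x (U.preimage Fin.castSucc (Fin.castSucc_injective L).injOn)

theorem extend_of_mem (x : Grassmann L) {U : Finset (Fin (L + 1))} (h : Fin.last L ∈ U) :
    extend x U = 0 := if_pos h

theorem last_notMem_map (V : Finset (Fin L)) : Fin.last L ∉ V.map Fin.castSuccEmb := by
  simp [Fin.castSucc_ne_last]

theorem extend_map (x : Grassmann L) (V : Finset (Fin L)) :
    extend x (V.map Fin.castSuccEmb) = x V := by
  rw [extend, if_neg (last_notMem_map V)]
  congr 1
  ext i
  simp

theorem exists_eq_map {U : Finset (Fin (L + 1))} (h : Fin.last L ∉ U) :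
    ∃ V : Finset (Fin L), U = V.map Fin.castSuccEmb := by
  refine ⟨U.preimage Fin.castSucc (Fin.castSucc_injective L).injOn, ?_⟩
  ext i
  simp only [mem_map, mem_preimage, Fin.coe_castSuccEmb]
  constructor
  · intro hi
    obtain ⟨j, rfl⟩ := Fin.exists_castSucc_eq.2 (show i ≠ Fin.last L from fun h' => h (h' ▸ hi))
    exact ⟨j, hi, rfl⟩
  · rintro ⟨j, hj, rfl⟩
    exact hj

theorem sgn_map (S T : Finset (Fin L)) :
    sgn (S.map Fin.castSuccEmb) (T.map Fin.castSuccEmb) = sgn S T := by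
  unfold sgn inversions
  congr 1
  symm
  refine Finset.card_bij (fun p _ => (p.1.castSucc, p.2.castSucc)) ?_ ?_ ?_
  · rintro ⟨i, j⟩ h
    simpa using h
  · rintro ⟨i, j⟩ _ ⟨i', j'⟩ _ h
    simpa using h
  · rintro ⟨i, j⟩ h
    simp only [mem_filter, mem_product, mem_map, Fin.coe_castSuccEmb] at h
    obtain ⟨⟨⟨i', hi, rfl⟩, ⟨j', hj, rfl⟩⟩, hij⟩ := h
    exact ⟨(i', j'), by simpa [hi, hj] using hij, rfl⟩

/-- Monomials with the new generator have coefficient zero on both sides; on the others,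
`Fin.castSucc` preserves the order of the generators and hence the signs. -/
theorem extend_mul (x y : Grassmann L) : extend (x * y) = extend x * extend y := by
  ext U
  rw [mul_apply]
  by_cases h : Fin.last L ∈ U
  · rw [extend_of_mem _ h, Finset.sum_eq_zero]
    intro S hS
    by_cases hs : Fin.last L ∈ S
    · rw [extend_of_mem x hs]; ring
    · rw [extend_of_mem y (mem_sdiff.2 ⟨h, hs⟩)]; ring
  · obtain ⟨V, rfl⟩ := exists_eq_map h
    rw [extend_map, mul_apply]
    refine Finset.sum_bij (fun S _ => S.map Fin.castSuccEmb) ?_ ?_ ?_ ?_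
    · intro S hS
      simpa using hS
    · intro S _ T _ h
      exact Finset.map_injective _ h
    · intro T hT
      obtain ⟨S, rfl⟩ := exists_eq_map fun h' => h (mem_powerset.1 hT h')
      exact ⟨S, by simpa using hT, rfl⟩
    · intro S _
      rw [← Finset.map_sdiff, sgn_map, extend_map, extend_map]

theorem extend_one : extend (1 : Grassmann L) = 1 := by
  ext U
  by_cases h : Fin.last L ∈ U
  · rw [extend_of_mem _ h, one_apply, if_neg]
    rintro rfl
    simp at h
  · obtain ⟨V, rfl⟩ := exists_eq_map h
    rw [extend_map, one_apply, one_apply]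
    simp

/-- The inclusion of a Grassmann algebra into the one with an additional generator. -/
noncomputable def inclusion (L : ℕ) : GrassmannHom L (L + 1) where
  toAlgHom := AlgHom.ofLinearMap
    { toFun := extend
      map_add' := fun x y => by
        ext U
        by_cases h : Fin.last L ∈ U <;> simp [extend, h]
      map_smul' := fun c x => by
        ext U
        by_cases h : Fin.last L ∈ U <;> simp [extend, h] }
    extend_one extend_mul
  map_ev x hx U hU := by
    change extend x U = 0
    by_cases h : Fin.last L ∈ U
    · exact extend_of_mem x h
    · obtain ⟨V, rfl⟩ := exists_eq_map h
      rw [extend_map]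
      exact hx V (by simpa using hU)
  map_od x hx U hU := by
    change extend x U = 0
    by_cases h : Fin.last L ∈ U
    · exact extend_of_mem x h
    · obtain ⟨V, rfl⟩ := exists_eq_map h
      rw [extend_map]
      exact hx V (by simpa using hU)
  map_conj x := by
    change extend (conj x) = conj (extend x)
    ext U
    by_cases h : Fin.last L ∈ U <;> simp [extend, h, conj_apply]

theorem extend_injective : Function.Injective (extend : Grassmann L → Grassmann (L + 1)) :=
  fun x y h => ext fun V => by rw [← extend_map x, h, extend_map]

/-- The additional generator. -/
noncomputable def generator (L : ℕ) : Od (L + 1) :=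
  ⟨fun U => if U = {Fin.last L} then 1 else 0, fun U hU => if_neg fun h => by
    rw [h] at hU; simp at hU⟩

theorem conjOd_generator : conjOd (generator L) = generator L :=
  Od.ext (ext fun U => by
    change starRingEnd ℂ (if U = {Fin.last L} then 1 else 0) = if U = {Fin.last L} then 1 else 0
    split_ifs <;> simp)

theorem eq_zero_of_mul_generator {x : Grassmann L}
    (h : extend x * (generator L : Grassmann (L + 1)) = 0) : x = 0 := by
  ext V
  -- In this coefficient only the splitting that gives the new generator alone to the second factor
  -- survives, and it contributes `± x V`.
  have h1 := congrFun h (insert (Fin.last L) (V.map Fin.castSuccEmb))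
  rw [mul_apply, Finset.sum_eq_single (V.map Fin.castSuccEmb)] at h1
  · rw [Finset.insert_sdiff_of_notMem _ (last_notMem_map V), Finset.sdiff_self, extend_map] at h1
    change _ * _ * (if _ then (1 : ℂ) else 0) = 0 at h1
    rw [if_pos (by rfl), mul_one] at h1
    refine (mul_eq_zero.1 h1).resolve_left ?_
    exact norm_ne_zero_iff.1 ((norm_sgn _ _).trans_ne one_ne_zero)
  · intro S hS hSV
    by_cases hl : Fin.last L ∈ S
    · rw [extend_of_mem x hl]; ring
    · change _ * _ * (if _ then (1 : ℂ) else 0) = 0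
      rw [if_neg, mul_zero]
      intro he
      refine hSV ?_
      ext i
      by_cases hi : i = Fin.last L
      · subst hi
        simp [hl, last_notMem_map V]
      · have h3 : i ∉ insert (Fin.last L) (V.map Fin.castSuccEmb) \ S := by
          rw [he]; simpa using hi
        have h4 : i ∈ S → _ := fun h => mem_powerset.1 hS h
        simp only [mem_sdiff, mem_insert, hi, false_or, not_and, not_not] at h3 h4
        exact ⟨h4, h3⟩
  · intro h2
    exact absurd (mem_powerset.2 (Finset.subset_insert _ _)) h2

end Grassmann

namespace Grassmann

variable {L : ℕ}

theorem Ev.eq_zero_of_coe {x : Ev L} (h : (x : Grassmann L) = 0) : x = 0 := Ev.ext h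

theorem conjOd_zero : conjOd (0 : Od L) = 0 := Od.ext (map_zero conj)

theorem odMul_zero (x : Od L) : odMul x 0 = 0 := Ev.ext (mul_zero (x : Grassmann L))

theorem inclusion_ev_injective : Function.Injective (inclusion L).ev := fun _ _ h =>
  Ev.ext (extend_injective (congrArg Subtype.val h))

theorem eq_zero_of_odMul_generator {x : Od L}
    (h : odMul ((inclusion L).od x) (generator L) = 0) : x = 0 :=
  Od.ext (eq_zero_of_mul_generator (congrArg Subtype.val h))

end Grassmann

/-! ### Naturality and nondegeneracy of the form. -/

section

attribute [local irreducible] Grassmann.instNormedCommRingEv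

namespace SVec

open Grassmann

variable {ι : Type} {p L : ℕ} {τ : ℂ}

theorem isNonzero_map {L' : ℕ} (φ : GrassmannHom L L') {v : SVec ι p L} (hv : v.IsNonzero) :
    (v.map φ).IsNonzero := by
  obtain ⟨a, ha⟩ := hv
  exact ⟨a, by rwa [map_fst, φ.body_ev]⟩

variable [Fintype ι]

/-- The Hermitian pairing is nondegenerate, if an additional generator is allowed. -/
theorem eq_zero_of_herm_eq_zero (hτ : τ = Complex.I ∨ τ = -Complex.I) {u : SVec ι p L}
    (h : ∀ v : SVec ι p (L + 1), (u.map (inclusion L)).herm τ v = 0) : u = 0 := by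
  classical
  refine Prod.ext (funext fun a => ?_) (funext fun j => ?_)
  · have h1 := h (Pi.single a 1, 0)
    have h2 : (u.map (inclusion L)).herm τ ((Pi.single a 1, 0) : SVec ι p (L + 1)) =
        (inclusion L).ev (u.1 a) := by
      rw [herm, Finset.sum_eq_single a, Finset.sum_eq_zero]
      · simp [conjEv_eq, map_fst]
      · intro j _
        simp [conjOd_zero, odMul_zero]
      · intro b _ hb
        simp [hb, conjEv_eq]
      · simp
    rw [h2, ← _root_.map_zero (inclusion L).ev] at h1
    exact inclusion_ev_injective h1
  · have h1 := h (0, Pi.single j (generator L))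
    have h2 : (u.map (inclusion L)).herm τ ((0, Pi.single j (generator L)) : SVec ι p (L + 1)) =
        τ • odMul ((inclusion L).od (u.2 j)) (generator L) := by
      rw [herm, Finset.sum_eq_zero, Finset.sum_eq_single j]
      · simp [conjOd_generator, map_snd]
      · intro k _ hk
        simp [hk, conjOd_zero, odMul_zero]
      · simp
      · intro b _
        simp [conjEv_eq]
    rw [h2] at h1
    have hτ0 : τ ≠ 0 := by rcases hτ with rfl | rfl <;> simp
    exact eq_zero_of_odMul_generator ((smul_eq_zero.1 h1).resolve_left hτ0)

end SVec

namespace WeightedProj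

open Grassmann SVec

variable {n p m q L L' : ℕ} {τ : ℂ}

theorem ev_algebraMap (φ : GrassmannHom L L') (r : ℝ) :
    φ.ev (algebraMap ℝ (Ev L) r) = algebraMap ℝ (Ev L') r := by
  rw [Algebra.algebraMap_eq_smul_one, Algebra.algebraMap_eq_smul_one, real_smul_eq, real_smul_eq,
    _root_.map_smul, map_one]

theorem ev_weight (φ : GrassmannHom L L') (x : Pt n p m q L) :
    φ.ev (weight τ x) = weight τ (x.1.map φ, x.2.map φ) := by
  simp only [weight, _root_.map_mul, φ.ev_pow, ev_herm]

theorem ev_bracket (φ : GrassmannHom L L') (x X Y : Pt n p m q L) :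
    φ.ev (bracket τ x X Y) = bracket τ (x.1.map φ, x.2.map φ) (X.1.map φ, X.2.map φ)
      (Y.1.map φ, Y.2.map φ) := by
  simp only [bracket, _root_.map_mul, _root_.map_add, map_sub, map_pow, ev_herm, ev_algebraMap]

theorem slice_map (φ : GrassmannHom L L') (a : Fin n) (y : Model n p m q L a) :
    slice a (y.1.map φ, y.2.map φ) = ((slice a y).1.map φ, (slice a y).2.map φ) := by
  refine Prod.ext (Prod.ext (funext fun b => ?_) rfl) rfl
  rw [map_fst]
  by_cases h : b = a <;> simp [slice, h, map_fst]

theorem sliceL_map (φ : GrassmannHom L L') (a : Fin n) (Y : Model n p m q L a) :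
    sliceL a (Y.1.map φ, Y.2.map φ) = ((sliceL a Y).1.map φ, (sliceL a Y).2.map φ) := by
  refine Prod.ext (Prod.ext (funext fun b => ?_) rfl) rfl
  rw [map_fst]
  by_cases h : b = a <;> simp [sliceL_apply, h, map_fst]

/-- The explicit expression is built from sums, products, pairings and powers, each of which
commutes with `φ`. -/
theorem form_natural (hτ : τ = Complex.I ∨ τ = -Complex.I) (φ : GrassmannHom L L') {a : Fin n}
    {y : Model n p m q L a} (hy : y ∈ target a) (X Y : Model n p m q L a) :
    form τ n p m q L' a (y.1.map φ, y.2.map φ) ![(X.1.map φ, X.2.map φ), (Y.1.map φ, Y.2.map φ)] =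
      φ.toFun (form τ n p m q L a y ![X, Y]) := by
  have hy' : ((y.1.map φ, y.2.map φ) : Model n p m q L' a) ∈ target a := isNonzero_map φ hy
  rw [form_apply hτ hy, form_apply hτ hy', ← φ.ev_coe, explicitForm_eq, explicitForm_eq,
    _root_.map_smul, _root_.map_mul, ev_weight, ev_bracket, slice_map, sliceL_map, sliceL_map]

/-- The vectors that represent the explicit form through the Hermitian pairing. -/
noncomputable def dual (τ : ℂ) (x X : Pt n p m q L) : Pt n p m q L :=
  let A := x.1.herm τ x.1
  let B := x.2.herm τ x.2
  let D := algebraMap ℝ (Ev L) (1 / 2) * (B * X.1.herm τ x.1 - A * X.2.herm τ x.2)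
  ((A * B ^ 2) • X.1 + (-(B * D)) • x.1, (A ^ 2 * B) • X.2 + (A * D) • x.2)

theorem bracket_eq_dual (hτ : τ = Complex.I ∨ τ = -Complex.I) (x X Y : Pt n p m q L) :
    bracket τ x X Y =
      ((dual τ x X).1.herm τ Y.1 + (dual τ x X).2.herm τ Y.2) -
        conjHom L ((dual τ x X).1.herm τ Y.1 + (dual τ x X).2.herm τ Y.2) := by
  simp only [dual, bracket, herm_add_left, herm_smul_left, _root_.map_add, _root_.map_mul,
    map_sub, map_neg, map_pow, conjHom_herm hτ, conjHom_algebraMap]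
  ring

theorem dual_map (φ : GrassmannHom L L') (x X : Pt n p m q L) :
    dual τ (x.1.map φ, x.2.map φ) (X.1.map φ, X.2.map φ) =
      ((dual τ x X).1.map φ, (dual τ x X).2.map φ) := by
  simp only [dual, SVec.map_add, SVec.map_smul, _root_.map_mul, map_neg, map_sub, map_pow, ev_herm,
    ev_algebraMap]

/-- Let `z` be the left side. Testing with `Y` gives `z = z̄`, testing with `i Y` gives `z = -z̄`.
-/
theorem herm_dual_eq_zero (hτ : τ = Complex.I ∨ τ = -Complex.I) {x X : Pt n p m q L}
    (h : ∀ Y, bracket τ x X Y = 0) (Y : Pt n p m q L) :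
    (dual τ x X).1.herm τ Y.1 + (dual τ x X).2.herm τ Y.2 = 0 := by
  have h1 := h Y
  have h2 := h (algebraMap ℂ (Ev L) Complex.I • Y)
  have hI : conjHom L (algebraMap ℂ (Ev L) Complex.I) = -algebraMap ℂ (Ev L) Complex.I := by
    rw [Algebra.algebraMap_eq_smul_one, conjHom_smul, map_one, Complex.conj_I, neg_smul]
  have hI2 : algebraMap ℂ (Ev L) Complex.I * algebraMap ℂ (Ev L) Complex.I = -1 := by
    rw [← _root_.map_mul, Complex.I_mul_I, map_neg, map_one]
  rw [bracket_eq_dual hτ] at h1 h2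
  simp only [Prod.smul_fst, Prod.smul_snd, herm_smul_right, ← mul_add, _root_.map_mul, hI,
    map_neg] at h2
  have he := two_mul_half (L := L)
  linear_combination algebraMap ℝ (Ev L) (1 / 2) * (h1 + algebraMap ℂ (Ev L) Complex.I * h2) +
    (-((dual τ x X).1.herm τ Y.1 + (dual τ x X).2.herm τ Y.2)) * he +
    algebraMap ℝ (Ev L) (1 / 2) * ((dual τ x X).1.herm τ Y.1 + (dual τ x X).2.herm τ Y.2 +
      conjHom L ((dual τ x X).1.herm τ Y.1 + (dual τ x X).2.herm τ Y.2)) * hI2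

theorem bracket_eq_zero_of_form (hτ : τ = Complex.I ∨ τ = -Complex.I) {a : Fin n}
    {y : Model n p m q L a} (hy : y ∈ target a) {X : Model n p m q L a}
    (h : ∀ Y, form τ n p m q L a y ![X, Y] = 0) (Y : Pt n p m q L) :
    bracket τ (slice a y) (sliceL a X) Y = 0 := by
  have hx := slice_mem_X₀ hy
  -- Since the slice has `vᵃ = 1`, this vertical correction removes the `a`-th coordinate of `Y`.
  -- The result is tangent to the slice, and the bracket does not notice the change.
  let Z : Pt n p m q L := Y + ((-Y.1.1 a) • (slice a y).1, (-(-Y.1.1 a)) • (slice a y).2)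
  have hZ : sliceL a (restrictL a Z) = Z := by
    refine Prod.ext (Prod.ext (funext fun b => ?_) rfl) rfl
    by_cases hb : b = a
    · subst hb
      simp [sliceL_apply, Z, slice_apply_self]
    · simp [sliceL_apply, restrictL_apply, hb]
  have h1 : bracket τ (slice a y) (sliceL a X) Z = 0 := by
    have h2 := h (restrictL a Z)
    rw [form_apply hτ hy, hZ] at h2
    have h3 : explicitForm τ (slice a y) (sliceL a X) Z = 0 := Ev.eq_zero_of_coe h2
    rw [explicitForm_eq] at h3
    exact (isPos_weight hτ hx).isUnit.mul_left_cancel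
      (((smul_eq_zero.1 h3).resolve_left (by simp)).trans (mul_zero _).symm)
  rw [bracket_swap, bracket_add_left, bracket_vertical, add_zero, ← bracket_swap] at h1
  exact h1

theorem isNondegenerate_form (hτ : τ = Complex.I ∨ τ = -Complex.I) :
    IsNondegenerate (form τ n p m q) := fun L a y hy X h => by
  have hx := slice_mem_X₀ hy
  have hy' : ((y.1.map (inclusion L), y.2.map (inclusion L)) : Model n p m q (L + 1) a) ∈ target a :=
    isNonzero_map _ hy
  have h1 := herm_dual_eq_zero hτ (bracket_eq_zero_of_form hτ hy' (h (L + 1) (inclusion L)))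
  rw [slice_map, sliceL_map, dual_map] at h1
  have hd1 : (dual τ (slice a y) (sliceL a X)).1 = 0 := eq_zero_of_herm_eq_zero hτ fun v => by
    have := h1 (v, 0)
    rwa [← hermL_apply _ (0 : SVec (Fin m) q (L + 1)), map_zero, add_zero] at this
  have hd2 : (dual τ (slice a y) (sliceL a X)).2 = 0 := eq_zero_of_herm_eq_zero hτ fun v => by
    have := h1 (0, v)
    rwa [← hermL_apply _ (0 : SVec (Fin n) p (L + 1)), map_zero, zero_add] at this
  have hA := (isPos_fst hτ hx).isUnit
  have hB := (isPos_snd hτ hx).isUnit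
  obtain ⟨D, hD⟩ : ∃ D, D = algebraMap ℝ (Ev L) (1 / 2) *
      ((slice a y).2.herm τ (slice a y).2 * (sliceL a X).1.herm τ (slice a y).1 -
      (slice a y).1.herm τ (slice a y).1 * (sliceL a X).2.herm τ (slice a y).2) := ⟨_, rfl⟩
  simp only [dual, ← hD] at hd1 hd2
  -- The `a`-th coordinate of `hd1` reads `-B D = 0`, because `sliceL a X` has `a`-th coordinate `0`
  -- and the slice has `1`. Without `D`, the dual vector is `X` multiplied by units.
  have hD0 : D = 0 := by
    have h2 := congrFun (congrArg Prod.fst hd1) a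
    simp only [Prod.fst_add, Prod.smul_fst, Pi.add_apply, Pi.smul_apply, slice_apply_self,
      sliceL_apply, dif_pos, zero_add, smul_eq_mul, mul_one, mul_zero] at h2
    exact hB.mul_left_cancel ((neg_eq_zero.1 h2).trans (mul_zero _).symm)
  rw [hD0, mul_zero, neg_zero, zero_smul, add_zero] at hd1
  rw [hD0, mul_zero, zero_smul, add_zero] at hd2
  have h3 : sliceL a X = 0 :=
    Prod.ext ((hA.mul (hB.pow 2)).smul_eq_zero.1 hd1) (((hA.pow 2).mul hB).smul_eq_zero.1 hd2)
  rw [← restrictL_sliceL a X, h3, map_zero]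

theorem isForm_form (hτ : τ = Complex.I ∨ τ = -Complex.I) : IsForm (form τ n p m q) where
  smooth _ a := contDiffOn_form hτ a
  linear _ _ _ hy _ hc X Y := form_linear hτ hy hc X Y
  deriv_linear _ _ _ hy _ hc X Y Z := form_deriv_linear hτ hy hc X Y Z
  natural _ _ φ _ _ hy X Y := form_natural hτ φ hy X Y
  compatible _ a b _ hy hya := form_compatible hτ a b hy hya

end WeightedProj

end

open WeightedProj in
theorem mainTheorem2 (n p m q : ℕ) (τ : ℂ) (hτ : τ = Complex.I ∨ τ = -Complex.I) :
    ∃ ω : FormData n p m q,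
      IsForm ω ∧ IsReductionOf τ ω ∧ IsClosedForm ω ∧ IsNondegenerate ω ∧
      (∀ ω' : FormData n p m q, IsForm ω' → IsReductionOf τ ω' →
        ∀ (L : ℕ) (a : Fin n), Set.EqOn (ω' L a) (ω L a) (target a)) ∧
      ∀ (L : ℕ), ∀ x ∈ X₀ n p m q L, ∀ a : Fin n, proj x ∈ source a → ∀ X Y,
        pullback ω proj a x ![X, Y] =
          ω₀ τ (fderiv ℝ (WeightedProj.s τ) x X) (fderiv ℝ (WeightedProj.s τ) x Y) ∧
        pullback ω proj a x ![X, Y] = explicitForm τ x X Y := by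
  refine ⟨form τ n p m q, isForm_form hτ, isReductionOf_form hτ, isClosedForm_form hτ,
    isNondegenerate_form hτ, fun ω _ hω L a => reduction_unique hτ hω L a,
    fun L x hx a hxa X Y => ⟨?_, pullback_proj hτ hxa X Y⟩⟩
  rw [pullback_proj hτ hxa, omega_fderiv_s hτ hx]
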